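/- Let $K$ be an algebraically closed field of any characteristic, let $n\ge 2$ and $\ell\ge 1$ be integers, and let $\underline{x}=(x_1,\dots,x_n)$ and $\underline{\lambda}=(\lambda_1,\dots,\lambda_\ell)$ be tuples of independent variables. Let $P,Q_1,\dots,Q_\ell\in K[\underline{x}]$ be non-zero polynomials, pairwise not proportional by a constant of $K$, not all constant, and without non-constant common divisor of all of them. Put $F=P+\lambda_1Q_1+\cdots+\lambda_\ell Q_\ell$, viewed as a polynomial in $\underline{x}$ over the algebraic closure $\overline{K(\underline{\lambda})}$, and let $\deg$ denote the total degree in $\underline{x}$. A *homogeneous decomposition* of $F$ of degree $d$ consists of two relatively prime polynomials $\phi,\psi\in K[\underline{x}]$ with $\max(\deg\phi,\deg\psi)<\deg F$ and a form $H\in\overline{K(\underline{\lambda})}[u,v]$, homogeneous of degree $d$ in $(u,v)$, such that $F=H(\phi,\psi)$. It is *maximal* if, for a new variable $\lambda$, the polynomial $\phi+\lambda\psi$ is irreducible in $\overline{K(\lambda)}[\underline{x}]$. It is *reduced* if $H$ has no linear factor $\alpha u+\beta v$ with $(\alpha,\beta)\in K^2\setminus\{(0,0)\}$ such that $\alpha\phi+\beta\psi$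 is constant. The polynomial $F$ is *composed over $\overline{K(\underline{\lambda})}$* if $F=r(S)$ for some $S\in\overline{K(\underline{\lambda})}[\underline{x}]$ and some one-variable polynomial $r$ over $\overline{K(\underline{\lambda})}$ with $\deg r\ge 2$. If $F$ has a homogeneous decomposition, then it has one that is reduced and maximal, and all reduced maximal homogeneous decompositions of $F$ have the same degree $\delta$. If moreover $F$ is not composed over $\overline{K(\underline{\lambda})}$, then every homogeneous decomposition of $F$ has degree $\le\delta$, with equality if and only if it is maximal. -/

import Mathlib

open MvPolynomial

noncomputable section

/-- The algebraic closure of `K(λ₁, …, λ_ℓ)`, with `λ₁, …, λ_ℓ` independent variables. -/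
abbrev ParamField (K : Type*) [Field K] (ℓ : ℕ) : Type _ :=
  AlgebraicClosure (FractionRing (MvPolynomial (Fin ℓ) K))

/-- The variable `λᵢ`, as an element of the algebraic closure of `K(λ₁, …, λ_ℓ)`. -/
def param (K : Type*) [Field K] {ℓ : ℕ} (i : Fin ℓ) : ParamField K ℓ :=
  algebraMap (FractionRing (MvPolynomial (Fin ℓ) K)) (ParamField K ℓ)
    (algebraMap (MvPolynomial (Fin ℓ) K) (FractionRing (MvPolynomial (Fin ℓ) K)) (X i))

/-- `F = P + λ₁ Q₁ + ⋯ + λ_ℓ Q_ℓ`, as a polynomial in `x₁, …, xₙ` with coefficients in the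
algebraic closure of `K(λ₁, …, λ_ℓ)`. -/
def linearFamily {K : Type*} [Field K] {n ℓ : ℕ}
    (P : MvPolynomial (Fin n) K) (Q : Fin ℓ → MvPolynomial (Fin n) K) :
    MvPolynomial (Fin n) (ParamField K ℓ) :=
  map (algebraMap K (ParamField K ℓ)) P
    + ∑ i, C (param K i) * map (algebraMap K (ParamField K ℓ)) (Q i)

/-- A homogeneous decomposition `F = H(φ, ψ)` of a polynomial `F` over an extension `L` of `K`:
`φ` and `ψ` are relatively prime polynomials over `K` of degree less than that of `F`, and
`H(u, v)` is homogeneous over `L`. If `F ≠ 0` then `H ≠ 0`, so that `degree` is determined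
by `H`. -/
structure HomogDecomp (K : Type*) [Field K] {L : Type*} [Field L] [Algebra K L] {n : ℕ}
    (F : MvPolynomial (Fin n) L) where
  /-- the first polynomial over `K` -/
  φ : MvPolynomial (Fin n) K
  /-- the second polynomial over `K` -/
  ψ : MvPolynomial (Fin n) K
  isRelPrime : IsRelPrime φ ψ
  totalDegree_lt : max φ.totalDegree ψ.totalDegree < F.totalDegree
  /-- the form in `u = X 0` and `v = X 1` -/
  H : MvPolynomial (Fin 2) L
  /-- the degree of the decomposition -/
  degree : ℕ
  isHomogeneous : H.IsHomogeneous degree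
  eq_comp : F = aeval ![map (algebraMap K L) φ, map (algebraMap K L) ψ] H

namespace HomogDecomp

variable {K : Type*} [Field K] {L : Type*} [Field L] [Algebra K L] {n : ℕ}
  {F : MvPolynomial (Fin n) L}

/-- The decomposition is maximal if `φ + λ ψ` is irreducible over the algebraic closure of
`K(λ)`, where `λ` is a new single variable. -/
def IsMaximal (D : HomogDecomp K F) : Prop :=
  Irreducible
    (map (algebraMap K (AlgebraicClosure (RatFunc K))) D.φ
      + C (algebraMap (RatFunc K) (AlgebraicClosure (RatFunc K)) RatFunc.X)
        * map (algebraMap K (AlgebraicClosure (RatFunc K))) D.ψ)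

/-- The decomposition is reduced if `H` has no linear factor `α u + β v` with `α, β ∈ K` such
that `α φ + β ψ` is constant. -/
def IsReduced (D : HomogDecomp K F) : Prop :=
  ¬ ∃ α β : K, (α, β) ≠ (0, 0) ∧
    (C (algebraMap K L α) * X 0 + C (algebraMap K L β) * X 1 : MvPolynomial (Fin 2) L) ∣ D.H ∧
    ∃ c : K, C α * D.φ + C β * D.ψ = C c

end HomogDecomp

/-- `F` is a composed polynomial over `L`: `F = r(S)` with `r` in one variable of degree at
least `2`. -/
def IsComposed {L : Type*} [Field L] {n : ℕ} (F : MvPolynomial (Fin n) L) : Prop :=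
  ∃ (r : Polynomial L) (S : MvPolynomial (Fin n) L), 2 ≤ r.natDegree ∧ F = Polynomial.aeval S r

end

open MvPolynomial

noncomputable section

/-! ### Binary forms, their common zeros and their linear factors -/

section BinaryForms

/-! Write L for `ParamField K ℓ`. As L is algebraically closed, H is a product of linear forms, so F
= H(φ, ψ) is, up to a constant, a product of `degree` many combinations αφ + βψ. Each pair (α, β) is
either proportional to a pair from K² or has a ratio transcendental over K
(`exists_smul_or_transcendental`). In the first case the combination, rescaled to K, divides F,
hence divides P and every Qᵢ (`dvd_of_map_dvd_linearFamily`), hence is constant; reducedness forbids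
such factors. In the second case it is, up to scaling, a generic member of the pencil φ + λψ, so it
is irreducible exactly when the decomposition is maximal (`irreducible_linear_combination_iff`).
Thus a reduced maximal decomposition exhibits F as a product of `degree` many irreducibles, and δ is
the number of irreducible factors of F. If F is not composed, no nontrivial combination of φ and ψ
is constant (`isComposed_of_linComb_eq_C`), so every decomposition splits F into `degree` many
nonunits: the degree is at most δ, with equality iff these nonunits are all irreducible.

Existence rests on the Bertini–Krull theorem for pencils (`exists_comp_of_not_irreducible`): a
decomposition that is not maximal factors through a pencil of smaller degree, so descent ends at a
maximal one; replacing constant linear factors by their values then lowers the degree of H until it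
is reduced. For Bertini–Krull, put t = -φ/ψ and let λ act on K(x) as t. Then φ + λψ generates the
relations over K(λ) between the coordinates (`pencil_dvd`). If K(t) is algebraically closed in K(x),
this generator is absolutely irreducible unless all its derivatives vanish
(`irreducible_map_or_pderiv_eq_zero`), and in that exception φ and ψ are p-th powers. Otherwise some
c outside K(t) is algebraic over K(t); by Lüroth K(t, c) = K(θ), and t is a rational function of
degree at least 2 in θ. Numerator and denominator of θ span the smaller pencil. -/

theorem aeval_homogenize_eq_sum {K R : Type*} [CommRing K] [CommRing R] [Algebra K R]
    (p : Polynomial K) (d : ℕ) (a b : R) :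
    aeval ![a, b] (p.homogenize d)
      = ∑ i ∈ Finset.range (d + 1), algebraMap K R (p.coeff i) * (a ^ i * b ^ (d - i)) := by
  rw [← Finset.Nat.sum_antidiagonal_eq_sum_range_succ
    (fun i j => algebraMap K R (p.coeff i) * (a ^ i * b ^ j)), Polynomial.homogenize, map_sum]
  refine Finset.sum_congr rfl fun kl _ => ?_
  simp [aeval_monomial, Finsupp.prod_fintype, Fin.prod_univ_two]

theorem aeval_homogenize_of_ne_zero {K R : Type*} [CommRing K] [Field R] [Algebra K R]
    (p : Polynomial K) {d : ℕ} (hd : p.natDegree ≤ d) (a : R) {b : R} (hb : b ≠ 0) :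
    aeval ![a, b] (p.homogenize d) = b ^ d * Polynomial.aeval (a / b) p := by
  rw [aeval_homogenize_eq_sum, Polynomial.aeval_eq_sum_range' (Nat.lt_succ_of_le hd),
    Finset.mul_sum]
  refine Finset.sum_congr rfl fun i hi => ?_
  have hi : i ≤ d := Nat.lt_succ_iff.mp (Finset.mem_range.mp hi)
  obtain ⟨j, rfl⟩ := Nat.exists_eq_add_of_le hi
  rw [Algebra.smul_def, div_pow, Nat.add_sub_cancel_left, pow_add]
  field_simp

theorem aeval_homogenize_zero_right {K R : Type*} [CommRing K] [CommRing R] [Algebra K R]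
    (p : Polynomial K) (d : ℕ) (a : R) :
    aeval ![a, 0] (p.homogenize d) = algebraMap K R (p.coeff d) * a ^ d := by
  rw [aeval_homogenize_eq_sum, Finset.sum_range_succ, Finset.sum_eq_zero]
  · simp
  · intro i hi
    have hi := Finset.mem_range.mp hi
    rw [zero_pow (by omega)]
    simp

/-- Two coprime binary forms of the same positive degree have only the trivial common zero. -/
theorem eq_zero_of_aeval_homogenize_eq_zero {K R : Type*} [Field K] [CommRing R] [IsDomain R]
    [Algebra K R] {p q : Polynomial K} (hpq : IsCoprime p q) {d : ℕ}
    (hd : max p.natDegree q.natDegree = d) (hd0 : d ≠ 0) {a b : R}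
    (hp : aeval ![a, b] (p.homogenize d) = 0) (hq : aeval ![a, b] (q.homogenize d) = 0) :
    a = 0 ∧ b = 0 := by
  have hb : b = 0 := by
    by_contra hb
    let F := FractionRing R
    have key : ∀ s : Polynomial K, s.natDegree ≤ d → aeval ![a, b] (s.homogenize d) = 0 →
        Polynomial.aeval (algebraMap R F a / algebraMap R F b) s = 0 := by
      intro s hs h0
      have hb' : algebraMap R F b ≠ 0 := by
        simpa using hb
      have h1 := aeval_homogenize_of_ne_zero s hs (algebraMap R F a) hb'
      have h2 : aeval ![algebraMap R F a, algebraMap R F b] (s.homogenize d) = 0 := by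
        have := congrArg (algebraMap R F) h0
        rw [map_zero, aeval_homogenize_eq_sum, map_sum] at this
        rw [aeval_homogenize_eq_sum, ← this]
        refine Finset.sum_congr rfl fun i _ => ?_
        rw [map_mul, map_mul, map_pow, map_pow, ← IsScalarTower.algebraMap_apply]
      rw [h2] at h1
      exact (mul_eq_zero.mp h1.symm).resolve_left (pow_ne_zero _ hb')
    -- Both polynomials vanish at a/b in the fraction field, so evaluating the Bézout identity there
    -- gives 0 = 1.
    obtain ⟨u, v, huv⟩ := hpq
    have := congrArg (Polynomial.aeval (algebraMap R F a / algebraMap R F b)) huv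
    rw [map_add, map_mul, map_mul, key p (hd ▸ le_max_left _ _) hp,
      key q (hd ▸ le_max_right _ _) hq] at this
    simp at this
  subst hb
  refine ⟨?_, rfl⟩
  rw [aeval_homogenize_zero_right] at hp hq
  by_contra ha
  have hpd : p.coeff d = 0 := by
    simpa [ha, FaithfulSMul.algebraMap_eq_zero_iff] using hp
  have hqd : q.coeff d = 0 := by
    simpa [ha, FaithfulSMul.algebraMap_eq_zero_iff] using hq
  -- At b = 0 only the coefficients of index d survive, and the polynomial attaining the maximal
  -- degree d has a nonzero one.
  rcases max_choice p.natDegree q.natDegree with h | h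
  · rw [hd] at h
    rw [h] at hpd
    have := Polynomial.leadingCoeff_eq_zero.mp hpd
    rw [this] at h; simp at h; exact hd0 h
  · rw [hd] at h
    rw [h] at hqd
    have := Polynomial.leadingCoeff_eq_zero.mp hqd
    rw [this] at h; simp at h; exact hd0 h

/-- Over an algebraically closed field a binary form is a product of linear forms. -/
theorem exists_eq_prod_linear_forms {L : Type*} [Field L] [IsAlgClosed L]
    {H : MvPolynomial (Fin 2) L} {d : ℕ} (hH : H.IsHomogeneous d) (h0 : H ≠ 0) :
    ∃ (c : L) (s : Multiset (L × L)), c ≠ 0 ∧ Multiset.card s = d ∧ (∀ p ∈ s, p ≠ (0, 0)) ∧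
      H = C c * (s.map fun p => C p.1 * X 0 + C p.2 * X 1).prod := by
  have hlin : ∀ s : Multiset (L × L),
      (s.map fun p => C p.1 * X 0 + C p.2 * X 1 : Multiset (MvPolynomial (Fin 2) L)).prod.IsHomogeneous
        (Multiset.card s) := by
    intro s
    induction s using Multiset.induction_on with
    | empty => simpa using isHomogeneous_one (Fin 2) L
    | cons p s ih =>
      rw [Multiset.map_cons, Multiset.prod_cons, Multiset.card_cons, Nat.add_comm _ 1]
      refine IsHomogeneous.mul (IsHomogeneous.add ?_ ?_) ih
      · simpa using (isHomogeneous_C (Fin 2) p.1).mul (isHomogeneous_X L (0 : Fin 2))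
      · simpa using (isHomogeneous_C (Fin 2) p.2).mul (isHomogeneous_X L (1 : Fin 2))
  set p : Polynomial L := aeval ![Polynomial.X, 1] H with hp
  have hpH : p.homogenize d = H := Polynomial.homogenize_eq_of_isHomogeneous hH rfl
  have hp0 : p ≠ 0 := by
    intro h; rw [h] at hpH; simp at hpH; exact h0 hpH.symm
  have hsplit := IsAlgClosed.splits p
  have hcard : Multiset.card p.roots ≤ d := by
    refine (Polynomial.card_roots' p).trans ?_
    by_contra hlt
    push Not at hlt
    have hpd : p.natDegree ≤ d := by
      rw [hp, MvPolynomial.aeval_def, MvPolynomial.eval₂_eq']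
      refine Polynomial.natDegree_sum_le_of_forall_le _ _ fun m hm => ?_
      have hm' := hH (mem_support_iff.mp hm)
      have h2 : m 0 + m 1 = d := by
        simpa [Finsupp.weight_apply, Finsupp.sum_fintype, Fin.sum_univ_two] using hm'
      simp only [Fin.prod_univ_two, Matrix.cons_val_zero, Matrix.cons_val_one, one_pow, mul_one]
      refine (Polynomial.natDegree_C_mul_X_pow_le _ _).trans (by omega)
    omega
  -- With p = H(u, 1), a root a contributes u - a v, and the degree lost on setting v = 1 comes back
  -- as copies of the form v.
  refine ⟨p.leadingCoeff, p.roots.map (fun a => (1, -a)) + Multiset.replicate (d - Multiset.card p.roots) (0, 1),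
    by simpa using hp0, ?_, ?_, ?_⟩
  · simp; omega
  · intro x hx
    rcases Multiset.mem_add.mp hx with h | h
    · obtain ⟨a, -, rfl⟩ := Multiset.mem_map.mp h
      simp
    · rw [Multiset.eq_of_mem_replicate h]; simp
  · rw [← hpH]
    apply Polynomial.homogenize_eq_of_isHomogeneous
    · have := (isHomogeneous_C (Fin 2) p.leadingCoeff).mul (hlin (p.roots.map (fun a => (1, -a)) +
        Multiset.replicate (d - Multiset.card p.roots) (0, 1)))
      convert this using 1
      simp; omega
    · rw [map_mul, map_multiset_prod, Multiset.map_map, Multiset.map_add, Multiset.prod_add]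
      conv_rhs => rw [hsplit.eq_prod_roots]
      simp [Multiset.map_map, sub_eq_add_neg]

end BinaryForms

/-! ### Absolute irreducibility of a generator of the relation ideal -/

section AbsoluteIrreducibility

theorem totalDegree_pderiv_lt {σ R : Type*} [CommRing R] {f : MvPolynomial σ R} {i : σ}
    (h : pderiv i f ≠ 0) : (pderiv i f).totalDegree < f.totalDegree := by
  obtain ⟨m, hm, hmd⟩ := Finset.exists_mem_eq_sup (pderiv i f).support (support_nonempty.mpr h)
    (fun s => s.sum fun _ e => e)
  have h1 : m + Finsupp.single i 1 ∈ f.support := by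
    rw [mem_support_iff] at hm ⊢
    rw [coeff_pderiv] at hm
    exact fun h0 => hm (by rw [h0, zero_mul])
  have h2 := le_totalDegree h1
  rw [totalDegree, hmd]
  rw [Finsupp.sum_add_index' (fun _ => rfl) (fun _ _ _ => rfl)] at h2
  simp at h2 ⊢
  omega

theorem pderiv_eq_zero_of_dvd {σ R : Type*} [CommRing R] [IsDomain R] {f : MvPolynomial σ R}
    {i : σ} (h : f ∣ pderiv i f) : pderiv i f = 0 := by
  by_contra h0
  obtain ⟨r, hr⟩ := h
  have h1 := totalDegree_pderiv_lt h0
  have hf : f ≠ 0 := by rintro rfl; simp at h0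
  have hr0 : r ≠ 0 := by rintro rfl; rw [hr] at h0; simp at h0
  rw [hr, totalDegree_mul_of_isDomain hf hr0] at h1
  omega

/-- An element of an algebraic closure of `M` fixed by all automorphisms is purely inseparable. -/
theorem mem_perfectClosure_of_forall_algEquiv {M Ω : Type*} [Field M] [Field Ω] [Algebra M Ω]
    [IsAlgClosure M Ω] {α : Ω} (h : ∀ τ : Ω ≃ₐ[M] Ω, τ α = α) : α ∈ perfectClosure M Ω := by
  classical
  have : IsAlgClosed Ω := IsAlgClosure.isAlgClosed M
  have : Algebra.IsAlgebraic M Ω := IsAlgClosure.isAlgebraic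
  have : Normal M Ω := IsAlgClosure.normal M Ω
  have hint : IsIntegral M α := Algebra.IsIntegral.isIntegral α
  rw [mem_perfectClosure_iff_natSepDegree_eq_one, Polynomial.natSepDegree_eq_of_isAlgClosed Ω,
    Finset.card_eq_one]
  refine ⟨α, ?_⟩
  ext β
  rw [Multiset.mem_toFinset, Finset.mem_singleton, ← isConjRoot_iff_mem_minpoly_aroots hint]
  constructor
  · intro hc
    obtain ⟨τ, hτ⟩ := isConjRoot_iff_exists_algEquiv.mp hc
    rw [← h τ] at hτ
    exact τ.injective hτ
  · rintro rfl; exact IsConjRoot.refl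

theorem exists_prime_dvd_of_map_eq_zero {R S : Type*} [CommRing R] [IsDomain R]
    [UniqueFactorizationMonoid R] [CommRing S] [IsDomain S] (ev : R →+* S) {F : R} (hF : F ≠ 0)
    (h : ev F = 0) : ∃ g, Prime g ∧ g ∣ F ∧ ev g = 0 := by
  obtain ⟨s, hs, hsF⟩ := UniqueFactorizationMonoid.exists_prime_factors F hF
  have h1 : ev s.prod = 0 := by
    obtain ⟨u, hu⟩ := hsF.symm
    rw [← hu, map_mul, h, zero_mul]
  rw [map_multiset_prod, Multiset.prod_eq_zero_iff, Multiset.mem_map] at h1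
  obtain ⟨g, hg, hg0⟩ := h1
  exact ⟨g, hs g hg, (Multiset.dvd_prod hg).trans hsF.dvd, hg0⟩

/-- Frobenius acts coefficientwise up to exponents, so one N bounding the exponents over the finite
support serves for all coefficients. -/
theorem pow_mem_range_map {σ K₀ k : Type*} [Field K₀] [Field k] [Algebra K₀ k] (q : ℕ)
    [ExpChar k q] {g : MvPolynomial σ k}
    (h : ∀ m, ∃ n, g.coeff m ^ q ^ n ∈ (algebraMap K₀ k).range) :
    ∃ N, g ^ q ^ N ∈ (map (σ := σ) (algebraMap K₀ k)).range := by
  choose e he using h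
  let N := g.support.sup e
  refine ⟨N, ?_⟩
  have : ExpChar (MvPolynomial σ k) q := expChar_of_injective_algebraMap (C_injective σ k) q
  rw [← iterateFrobenius_def, g.as_sum, map_sum]
  refine Subring.sum_mem _ fun m hm => ?_
  obtain ⟨j, hj⟩ := Nat.exists_eq_add_of_le (Finset.le_sup (f := e) hm : e m ≤ N)
  obtain ⟨a, ha⟩ := he m
  have hN : N = e m + j := hj
  rw [iterateFrobenius_def, monomial_pow, hN, pow_add, pow_mul, ← ha]
  exact ⟨monomial ((q ^ e m * q ^ j) • m) (a ^ q ^ j), by simp⟩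

/-- Let `f` generate the ideal of relations over `K₀` of a family `x` of elements of `M`, where
`K₀` is algebraically closed in `M`. Then `f` is absolutely irreducible, or all its partial
derivatives vanish. -/
theorem irreducible_map_or_pderiv_eq_zero {σ K₀ M k Ω : Type*} [Field K₀] [Field M] [Field k]
    [Field Ω] [Algebra K₀ M] [Algebra K₀ k] [IsAlgClosure K₀ k] [Algebra M Ω] [IsAlgClosure M Ω]
    [Algebra K₀ Ω] [IsScalarTower K₀ M Ω] [Algebra k Ω] [IsScalarTower K₀ k Ω]
    (x : σ → M) {f : MvPolynomial σ K₀} (hf0 : f ≠ 0) (hf : aeval x f = 0)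
    (hker : ∀ h : MvPolynomial σ K₀, aeval x h = 0 → f ∣ h)
    (hclosed : ∀ c : M, IsAlgebraic K₀ c → c ∈ (algebraMap K₀ M).range) :
    Irreducible (map (algebraMap K₀ k) f) ∨ ∀ i, pderiv i f = 0 := by
  have : Algebra.IsAlgebraic K₀ k := IsAlgClosure.isAlgebraic
  have : Normal K₀ k := IsAlgClosure.normal K₀ k
  let ev : MvPolynomial σ k →ₐ[k] Ω := aeval fun i => algebraMap M Ω (x i)
  have hev : ∀ h : MvPolynomial σ K₀,
      ev (map (algebraMap K₀ k) h) = algebraMap M Ω (aeval x h) := by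
    intro h
    simp only [ev, aeval_map_algebraMap]
    exact aeval_algebraMap_apply Ω x h
  have hev0 : ∀ h : MvPolynomial σ K₀, ev (map (algebraMap K₀ k) h) = 0 → f ∣ h := by
    intro h h0
    rw [hev] at h0
    exact hker h ((map_eq_zero (algebraMap M Ω)).mp h0)
  have hF0 : map (algebraMap K₀ k) f ≠ 0 := by
    rwa [Ne, map_eq_zero_iff _ (map_injective _ (algebraMap K₀ k).injective)]
  have hFev : ev (map (algebraMap K₀ k) f) = 0 := by rw [hev, hf, map_zero]
  obtain ⟨g₀, hg₀, hg₀F, hg₀ev⟩ := exists_prime_dvd_of_map_eq_zero ev.toRingHom hF0 hFev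
  obtain ⟨m₀, hm₀⟩ := ne_zero_iff.mp hg₀.ne_zero
  -- Normalising one coefficient to 1 turns later associatedness of conjugates of g into equality.
  obtain ⟨g, hgg₀, hgm⟩ : ∃ g, Associated g₀ g ∧ g.coeff m₀ = 1 :=
    ⟨C (g₀.coeff m₀)⁻¹ * g₀, ⟨((IsUnit.mk0 _ (inv_ne_zero hm₀)).map C).unit, mul_comm _ _⟩, by
      rw [coeff_C_mul, inv_mul_cancel₀ hm₀]⟩
  have hg : Prime g := hgg₀.prime_iff.mp hg₀
  have hgF : g ∣ map (algebraMap K₀ k) f := hgg₀.symm.dvd.trans hg₀F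
  have hgev : ev g = 0 := by
    obtain ⟨u, hu⟩ := hgg₀
    rw [← hu, map_mul]
    exact mul_eq_zero_of_left hg₀ev _
  -- Incomparability: k[x] is integral over K₀[x], and both the prime (g) and the kernel of `ev`
  -- contract to (f), so the inclusion between them is not strict.
  have hgen : ∀ h, ev h = 0 → g ∣ h := by
    let _ : Algebra (MvPolynomial σ K₀) (MvPolynomial σ k) := algebraMvPolynomial
    by_contra! hne
    obtain ⟨h, hh, hgh⟩ := hne
    have hJ : (Ideal.span {g}).IsPrime := (Ideal.span_singleton_prime hg.ne_zero).mpr hg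
    have hlt : Ideal.span {g} < RingHom.ker ev.toRingHom := by
      refine lt_of_le_of_ne ((Ideal.span_singleton_le_iff_mem _).mpr hgev) fun heq => hgh ?_
      rw [← Ideal.mem_span_singleton, heq]
      exact hh
    have := Ideal.IsIntegral.comap_lt_comap (R := MvPolynomial σ K₀) hlt
    refine this.not_ge fun r hr => ?_
    have hr' : ev (map (algebraMap K₀ k) r) = 0 := hr
    rw [Ideal.mem_comap, Ideal.mem_span_singleton]
    exact hgF.trans (_root_.map_dvd (map (algebraMap K₀ k)) (hev0 r hr'))
  -- τ restricts to the normal extension k and fixes the point x, so it sends g to another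
  -- irreducible relation; that relation is a constant multiple of g, and the normalisation makes
  -- the constant 1.
  have hfix : ∀ (τ : Ω ≃ₐ[M] Ω) (m : σ →₀ ℕ),
      τ (algebraMap k Ω (g.coeff m)) = algebraMap k Ω (g.coeff m) := by
    intro τ m
    let τ' : k ≃ₐ[K₀] k := (τ.restrictScalars K₀).restrictNormal k
    have hτ' : ∀ c, algebraMap k Ω (τ' c) = τ (algebraMap k Ω c) := fun c =>
      AlgEquiv.restrictNormal_commutes (τ.restrictScalars K₀) k c
    have h1 : ev (map (τ' : k →+* k) g) = τ (ev g) := by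
      generalize g = p
      induction p using MvPolynomial.induction_on with
      | C a => simpa [ev] using hτ' a
      | add p₁ p₂ h₁ h₂ => simp only [map_add, h₁, h₂]
      | mul_X p j h₁ => rw [map_mul, map_mul, map_mul, map_mul, h₁]; simp [ev]
    obtain ⟨r, hr⟩ := hgen (map (τ' : k →+* k) g) (by rw [h1, hgev, map_zero])
    have hirr : Irreducible (map (τ' : k →+* k) g) :=
      (MulEquiv.irreducible_iff (mapEquiv σ τ'.toRingEquiv)).mpr hg.irreducible
    have hru : IsUnit r := (hirr.isUnit_or_isUnit hr).resolve_left hg.not_isUnit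
    obtain ⟨c, -, rfl⟩ := isUnit_iff_eq_C_of_isReduced.mp hru
    have h2 := congrArg (coeff m₀) hr
    rw [coeff_map, mul_comm, coeff_C_mul, hgm, mul_one, map_one] at h2
    have h3 := congrArg (coeff m) hr
    rw [← h2, C_1, mul_one, coeff_map] at h3
    rw [← hτ']
    exact congrArg (algebraMap k Ω) h3
  let q := ringExpChar M
  have hqΩ : ExpChar Ω q := expChar_of_injective_algebraMap (algebraMap M Ω).injective q
  have hqk : ExpChar k q := ((algebraMap k Ω).expChar_iff (algebraMap k Ω).injective q).mpr hqΩ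
  -- The fixed coefficients are purely inseparable over M. Their q-power in M is algebraic over K₀,
  -- hence in K₀. In characteristic zero q = 1.
  obtain ⟨N, h, hh⟩ := pow_mem_range_map (K₀ := K₀) q (g := g) fun m => by
    obtain ⟨n, y, hy⟩ := mem_perfectClosure_of_forall_algEquiv (hfix · m)
    refine ⟨n, ?_⟩
    have halg : IsAlgebraic K₀ y := by
      rw [← isAlgebraic_algebraMap_iff (algebraMap M Ω).injective, hy]
      exact ((Algebra.IsAlgebraic.isAlgebraic (R := K₀) (g.coeff m)).algebraMap).pow _
    obtain ⟨a, rfl⟩ := hclosed y halg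
    refine ⟨a, (algebraMap k Ω).injective ?_⟩
    rw [map_pow, ← hy, ← IsScalarTower.algebraMap_apply, ← IsScalarTower.algebraMap_apply]
  have hFg : map (algebraMap K₀ k) f ∣ g ^ q ^ N := by
    have : f ∣ h := hev0 h (by
      rw [hh, map_pow, hgev, zero_pow (pow_ne_zero _ (expChar_ne_zero k q))])
    rw [← hh]
    exact _root_.map_dvd _ this
  obtain ⟨e, -, he⟩ := (dvd_prime_pow hg _).mp hFg
  rcases e with _ | _ | e
  · rw [pow_zero] at he
    exact (hg.not_isUnit (isUnit_of_dvd_unit hgF (associated_one_iff_isUnit.mp he))).elim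
  · left
    rw [zero_add, pow_one] at he
    exact he.symm.irreducible hg.irreducible
  · right
    intro i
    apply pderiv_eq_zero_of_dvd
    apply hev0
    -- Here g² divides the image of f, so g divides each of its derivatives; these vanish at x and
    -- are therefore divisible by f itself.
    obtain ⟨r, hr⟩ := (pow_dvd_pow g (Nat.le_add_left 2 e)).trans he.symm.dvd
    rw [← pderiv_map, hr, pow_two, pderiv_mul, pderiv_mul]
    simp [hgev]

end AbsoluteIrreducibility

/-! ### The pencil φ + λψ as a relation ideal -/

section Pencil

variable {K σ : Type*} [Field K]

/-- Polynomials in `λ` over `K[x]`, as polynomials in `x` over `K(λ)`. -/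
def pencilHom (K σ : Type*) [Field K] :
    Polynomial (MvPolynomial σ K) →+* MvPolynomial σ (RatFunc K) :=
  Polynomial.eval₂RingHom (map (algebraMap K (RatFunc K))) (C RatFunc.X)

theorem pencilHom_C (p : MvPolynomial σ K) :
    pencilHom K σ (Polynomial.C p) = map (algebraMap K (RatFunc K)) p := by
  simp [pencilHom]

theorem pencilHom_X : pencilHom K σ Polynomial.X = C RatFunc.X := by
  simp [pencilHom]

theorem pencilHom_map_C (p : Polynomial K) :
    pencilHom K σ (p.map C) = C (algebraMap (Polynomial K) (RatFunc K) p) := by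
  induction p using Polynomial.induction_on' with
  | add p q hp hq => rw [Polynomial.map_add, map_add, hp, hq, map_add, map_add]
  | monomial n a =>
    rw [Polynomial.map_monomial, ← Polynomial.C_mul_X_pow_eq_monomial, map_mul, map_pow,
      pencilHom_C, pencilHom_X, map_C, ← Polynomial.C_mul_X_pow_eq_monomial, map_mul, map_pow,
      map_mul, map_pow, RatFunc.algebraMap_X, RatFunc.algebraMap_C]
    rfl

/-- Clears denominators in λ, so that divisibility can be tested in K[x][λ]. -/
theorem exists_pencilHom_eq (h : MvPolynomial σ (RatFunc K)) :
    ∃ c : Polynomial K, c ≠ 0 ∧ ∃ h', C (algebraMap (Polynomial K) (RatFunc K) c) * h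
      = pencilHom K σ h' := by
  induction h using MvPolynomial.induction_on with
  | C a =>
    refine ⟨a.denom, a.denom_ne_zero, a.num.map C, ?_⟩
    rw [pencilHom_map_C, ← C_mul]
    congr 1
    conv_lhs => rw [← RatFunc.num_div_denom a, RatFunc.num_div_denom a]
    conv_lhs => rhs; rw [← RatFunc.num_div_denom a]
    exact mul_div_cancel₀ _ (RatFunc.algebraMap_ne_zero a.denom_ne_zero)
  | add p q hp hq =>
    obtain ⟨c, hc, p', hp⟩ := hp
    obtain ⟨d, hd, q', hq⟩ := hq
    refine ⟨c * d, mul_ne_zero hc hd, d.map C * p' + c.map C * q', ?_⟩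
    simp only [map_add, map_mul, pencilHom_map_C, ← hp, ← hq]
    ring
  | mul_X p i hp =>
    obtain ⟨c, hc, p', hp⟩ := hp
    refine ⟨c, hc, p' * Polynomial.C (X i), ?_⟩
    rw [map_mul, ← hp, pencilHom_C, map_X, mul_assoc]

theorem isPrimitive_pencil {φ ψ : MvPolynomial σ K} (h : IsRelPrime φ ψ) :
    (Polynomial.C ψ * Polynomial.X + Polynomial.C φ).IsPrimitive := by
  intro r hr
  rw [Polynomial.C_dvd_iff_dvd_coeff] at hr
  refine h ?_ ?_
  · simpa using hr 0
  · simpa using hr 1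

variable {M : Type*} [Field M] [Algebra (MvPolynomial σ K) M] [IsFractionRing (MvPolynomial σ K) M]

/-- For relatively prime `φ`, `ψ`, the polynomial `φ + λ ψ` generates the ideal of relations over
`K(λ)` of the generators of `K(x)`, when `λ` acts on `K(x)` as `-φ/ψ`. -/
theorem pencil_dvd [Algebra K M] [IsScalarTower K (MvPolynomial σ K) M] [Algebra (RatFunc K) M]
    [IsScalarTower K (RatFunc K) M] {φ ψ : MvPolynomial σ K} (hrel : IsRelPrime φ ψ) (hψ : ψ ≠ 0)
    (ht : algebraMap (RatFunc K) M RatFunc.X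
      = -(algebraMap (MvPolynomial σ K) M φ / algebraMap (MvPolynomial σ K) M ψ))
    (h : MvPolynomial σ (RatFunc K))
    (h0 : aeval (fun i => algebraMap (MvPolynomial σ K) M (X i)) h = 0) :
    map (algebraMap K (RatFunc K)) φ + C RatFunc.X * map (algebraMap K (RatFunc K)) ψ ∣ h := by
  classical
  have hψM : algebraMap (MvPolynomial σ K) M ψ ≠ 0 := by
    rwa [Ne, map_eq_zero_iff _ (IsFractionRing.injective (MvPolynomial σ K) M)]
  obtain ⟨c, hc, h', hh'⟩ := exists_pencilHom_eq h
  have hcomp : ∀ p : Polynomial (MvPolynomial σ K),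
      aeval (fun i => algebraMap (MvPolynomial σ K) M (X i)) (pencilHom K σ p)
        = (p.map (algebraMap (MvPolynomial σ K) M)).eval (algebraMap (RatFunc K) M RatFunc.X) := by
    intro p
    induction p using Polynomial.induction_on' with
    | add p q hp hq => rw [map_add, map_add, hp, hq, Polynomial.map_add, Polynomial.eval_add]
    | monomial n a =>
      rw [← Polynomial.C_mul_X_pow_eq_monomial, map_mul, map_pow, pencilHom_C, pencilHom_X,
        map_mul, map_pow, aeval_map_algebraMap, aeval_C]
      simp only [Polynomial.map_mul, Polynomial.map_C, Polynomial.map_pow, Polynomial.map_X,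
        Polynomial.eval_mul, Polynomial.eval_C, Polynomial.eval_pow, Polynomial.eval_X]
      congr 1
      have : (aeval fun i => algebraMap (MvPolynomial σ K) M (X i))
          = IsScalarTower.toAlgHom K (MvPolynomial σ K) M := by ext i; simp
      rw [this]; rfl
  have hroot : (h'.map (algebraMap (MvPolynomial σ K) M)).IsRoot
      (algebraMap (RatFunc K) M RatFunc.X) := by
    rw [Polynomial.IsRoot, ← hcomp, ← hh', map_mul, h0, mul_zero]
  -- Gauss's lemma: over K(x) the pencil is a multiple of λ - t, which divides `h'` there; being
  -- primitive in λ, it divides `h'` over K[x] as well.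
  have hdvd : Polynomial.C ψ * Polynomial.X + Polynomial.C φ ∣ h' := by
    have := Classical.arbitrary (NormalizedGCDMonoid (MvPolynomial σ K))
    refine (isPrimitive_pencil hrel).dvd_of_fraction_map_dvd_fraction_map (K := M) ?_
    refine dvd_trans ?_ (Polynomial.dvd_iff_isRoot.mpr hroot)
    refine ⟨Polynomial.C (algebraMap (MvPolynomial σ K) M ψ)⁻¹, ?_⟩
    simp only [Polynomial.map_add, Polynomial.map_mul, Polynomial.map_C, Polynomial.map_X]
    rw [add_mul, mul_right_comm, ← Polynomial.C_mul, ← Polynomial.C_mul, mul_inv_cancel₀ hψM,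
      Polynomial.C_1, one_mul, ht, Polynomial.C_neg, sub_neg_eq_add, div_eq_mul_inv]
  obtain ⟨r, hr⟩ := hdvd
  have hcu : IsUnit (C (algebraMap (Polynomial K) (RatFunc K) c) : MvPolynomial σ (RatFunc K)) :=
    (IsUnit.mk0 _ (RatFunc.algebraMap_ne_zero hc)).map C
  rw [← hcu.dvd_mul_left, hh', hr, map_mul, map_add, map_mul, pencilHom_C, pencilHom_C,
    pencilHom_X, mul_comm (map _ ψ), add_comm]
  exact dvd_mul_right _ _

/-- An algebraic ratio would lie in K, making φ a constant multiple of ψ; coprimality then forces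
both to be constant. -/
theorem transcendental_ratio [IsAlgClosed K] [Algebra K M] [IsScalarTower K (MvPolynomial σ K) M]
    {φ ψ : MvPolynomial σ K} (hrel : IsRelPrime φ ψ) (hψ : ψ ≠ 0)
    (hdeg : 0 < max φ.totalDegree ψ.totalDegree) :
    Transcendental K (-(algebraMap (MvPolynomial σ K) M φ / algebraMap (MvPolynomial σ K) M ψ)) := by
  intro halg
  have hψM : algebraMap (MvPolynomial σ K) M ψ ≠ 0 := by
    rwa [Ne, map_eq_zero_iff _ (IsFractionRing.injective (MvPolynomial σ K) M)]
  have hmem : -(algebraMap (MvPolynomial σ K) M φ / algebraMap (MvPolynomial σ K) M ψ)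
      ∈ (⊥ : IntermediateField K M) := by
    have := IsAlgClosed.algebraMap_bijective_of_isIntegral (k := K) (K := integralClosure K M)
    obtain ⟨c, hc⟩ := this.2 ⟨_, halg.isIntegral⟩
    exact IntermediateField.mem_bot.mpr ⟨c, congrArg Subtype.val hc⟩
  obtain ⟨c, hc⟩ := IntermediateField.mem_bot.mp hmem
  have h1 : φ = -C c * ψ := by
    apply IsFractionRing.injective (MvPolynomial σ K) M
    rw [map_mul, map_neg, ← algebraMap_eq, ← IsScalarTower.algebraMap_apply, hc]
    field_simp
  have hu : IsUnit ψ := hrel (h1 ▸ dvd_mul_left _ _) dvd_rfl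
  obtain ⟨d, -, rfl⟩ := isUnit_iff_eq_C_of_isReduced.mp hu
  rw [h1, ← C_neg, ← C_mul, totalDegree_C, totalDegree_C] at hdeg
  simp at hdeg

end Pencil

/-! ### Lüroth's theorem inside K(x₁, …, xₙ) -/

section Luroth

open IntermediateField

/-- A field generated by `x` and an element `y` algebraic over `K(x)` embeds into any field to
which some ring containing `x` and `y` maps, provided that `x` goes to a transcendental element. -/
theorem nonempty_algHom_adjoin_pair {K A M N : Type*} [Field K] [CommRing A] [Algebra K A]
    [Field M] [Algebra K M] [Field N] [Algebra K N] (i₁ : A →ₐ[K] M)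
    (h₁ : Function.Injective i₁) (i₂ : A →ₐ[K] N) (x y : A)
    (hy : IsAlgebraic K⟮i₁ x⟯ (i₁ y)) (hx : Transcendental K (i₂ x)) :
    Nonempty (adjoin K {i₁ x, i₁ y} →ₐ[K] N) := by
  open scoped IntermediateField.algebraAdjoinAdjoin in
  have hle : Algebra.adjoin K {i₁ x, i₁ y} ≤ i₁.range := by
    rw [Algebra.adjoin_le_iff]
    rintro _ (rfl | rfl)
    exacts [⟨x, rfl⟩, ⟨y, rfl⟩]
  let f : Algebra.adjoin K {i₁ x, i₁ y} →ₐ[K] N :=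
    i₂.comp ((AlgEquiv.ofInjective i₁ h₁).symm.toAlgHom.comp (Subalgebra.inclusion hle))
  have hfz : ∀ (z : A) (hz : i₁ z ∈ Algebra.adjoin K {i₁ x, i₁ y}), f ⟨i₁ z, hz⟩ = i₂ z := by
    intro z hz
    have : (AlgEquiv.ofInjective i₁ h₁).symm (Subalgebra.inclusion hle ⟨i₁ z, hz⟩) = z := by
      rw [AlgEquiv.symm_apply_eq]; rfl
    exact congrArg i₂ this
  have hle' : Algebra.adjoin K {i₁ x} ≤ Algebra.adjoin K {i₁ x, i₁ y} :=
    Algebra.adjoin_mono (by simp)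
  -- A nonzero z satisfies a polynomial over K[x] with nonzero constant term r(x). If f killed z, it
  -- would kill r(x), contradicting the transcendence of the image of x.
  have hfinj : Function.Injective f := by
    rw [injective_iff_map_eq_zero]
    intro z hz
    by_contra hz0
    have hzalg : IsAlgebraic K⟮i₁ x⟯ (z : M) := by
      have : Algebra.adjoin K {i₁ x, i₁ y} ≤
          ((algebraicClosure K⟮i₁ x⟯ M).restrictScalars K).toSubalgebra := by
        rw [Algebra.adjoin_le_iff]
        rintro _ (rfl | rfl)
        · exact mem_algebraicClosure_iff.mpr
            (isAlgebraic_algebraMap (⟨i₁ x, mem_adjoin_simple_self K _⟩ : K⟮i₁ x⟯))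
        · exact mem_algebraicClosure_iff.mpr hy
      exact mem_algebraicClosure_iff.mp (this z.2)
    rw [← IsFractionRing.isAlgebraic_iff (Algebra.adjoin K {i₁ x})] at hzalg
    obtain ⟨q, hq0, hq⟩ := hzalg.exists_nonzero_coeff_and_aeval_eq_zero
      (mem_nonZeroDivisors_of_ne_zero (by simpa using hz0))
    let q' := q.map (Subalgebra.inclusion hle').toRingHom
    have hq' : q'.eval z = 0 := by
      apply Subtype.val_injective
      have h1 := Polynomial.hom_eval₂ q (Subalgebra.inclusion hle').toRingHom
        (Algebra.adjoin K {i₁ x, i₁ y}).val.toRingHom z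
      rw [← Polynomial.eval_map] at h1
      exact h1.trans hq
    have h0 : f (q'.coeff 0) = 0 := by
      have h1 := congrArg f.toRingHom hq'
      rw [← Polynomial.eval_map_apply] at h1
      change (q'.map f.toRingHom).eval (f z) = f.toRingHom 0 at h1
      rw [hz, ← Polynomial.coeff_zero_eq_eval_zero, Polynomial.coeff_map, map_zero] at h1
      exact h1
    obtain ⟨r, hr⟩ : ∃ r : Polynomial K, Polynomial.aeval (i₁ x) r = (q.coeff 0 : M) :=
      (Algebra.adjoin_singleton_eq_range_aeval K (i₁ x)).le (q.coeff 0).2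
    have hr' : i₁ (Polynomial.aeval x r) = (q.coeff 0 : M) := by
      rw [← hr, Polynomial.aeval_algHom_apply]
    have h2 : q'.coeff 0 = ⟨i₁ (Polynomial.aeval x r), hr' ▸ hle' (q.coeff 0).2⟩ := by
      apply Subtype.val_injective
      simp only [q', Polynomial.coeff_map, hr']
      rfl
    rw [h2, hfz, ← Polynomial.aeval_algHom_apply] at h0
    have hr0 : r = 0 := (transcendental_iff.mp hx) r h0
    rw [hr0, map_zero] at hr
    exact hq0 (Subtype.val_injective hr.symm)
  exact ⟨IsFractionRing.liftAlgHom hfinj⟩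

/-- Lüroth for K(X) gives a generator of the image of E, which is pulled back along the embedding.
-/
theorem exists_adjoin_pair_eq_of_algHom {K M : Type*} [Field K] [Field M] [Algebra K M]
    {E : IntermediateField K M} (g : E →ₐ[K] RatFunc K) : ∃ θ : M, E = K⟮θ⟯ := by
  have hE := RatFunc.Luroth.eq_adjoin_generator (E := g.fieldRange)
  obtain ⟨θ, hθ⟩ : RatFunc.Luroth.generator g.fieldRange ∈ g.fieldRange :=
    RatFunc.Luroth.generator_mem
  have h1 : (K⟮θ⟯ : IntermediateField K E).map g = (⊤ : IntermediateField K E).map g := by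
    rw [adjoin_map, Set.image_singleton, ← AlgHom.fieldRange_eq_map, hE]
    congr 2
  have h2 : (K⟮θ⟯ : IntermediateField K E) = ⊤ :=
    IntermediateField.map_injective g h1
  refine ⟨(θ : M), ?_⟩
  have h3 := congrArg (IntermediateField.map E.val) h2
  rw [adjoin_map, Set.image_singleton, ← AlgHom.fieldRange_eq_map, fieldRange_val] at h3
  exact h3.symm

/-- A line in affine space along which a nonconstant fraction stays nonconstant. -/
theorem exists_line {K σ : Type*} [Field K] [Infinite K] {a w : MvPolynomial σ K} (hw : w ≠ 0)
    (haw : ∀ c : K, a ≠ C c * w) :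
    ∃ e : MvPolynomial σ K →ₐ[K] Polynomial K, e w ≠ 0 ∧ ∀ c : K, e a ≠ Polynomial.C c * e w := by
  obtain ⟨P₀, hP₀⟩ : ∃ P₀, eval P₀ w ≠ 0 := by
    by_contra! h
    exact hw (MvPolynomial.funext fun x => by simpa using h x)
  -- A second point at which a/w does not take its value at P₀; the line runs from P₀ (parameter 0)
  -- to P₁ (parameter 1).
  obtain ⟨P₁, hP₁⟩ : ∃ P₁, eval P₁ (a * C (eval P₀ w) - C (eval P₀ a) * w) ≠ 0 := by
    by_contra! h
    have h1 : a * C (eval P₀ w) - C (eval P₀ a) * w = 0 :=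
      MvPolynomial.funext fun x => by rw [h x, map_zero]
    refine haw (eval P₀ a / eval P₀ w) ?_
    have h2 : (C (eval P₀ w) : MvPolynomial σ K) ≠ 0 := by simpa using hP₀
    apply mul_right_cancel₀ h2
    rw [sub_eq_zero.mp h1, mul_right_comm, ← C_mul, div_mul_cancel₀ _ hP₀]
  let e : MvPolynomial σ K →ₐ[K] Polynomial K :=
    aeval fun i => Polynomial.C (P₀ i) + Polynomial.X * Polynomial.C (P₁ i - P₀ i)
  have he₀ : ∀ p, (e p).eval 0 = eval P₀ p := by
    intro p
    induction p using MvPolynomial.induction_on with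
    | C a => simp [e]
    | add p q hp hq => simp [hp, hq]
    | mul_X p i hp => rw [map_mul, Polynomial.eval_mul, hp]; simp [e]
  have he₁ : ∀ p, (e p).eval 1 = eval P₁ p := by
    intro p
    induction p using MvPolynomial.induction_on with
    | C a => simp [e]
    | add p q hp hq => simp [hp, hq]
    | mul_X p i hp => rw [map_mul, Polynomial.eval_mul, hp]; simp [e]
  refine ⟨e, fun h => hP₀ (by rw [← he₀, h, Polynomial.eval_zero]), fun c hc => hP₁ ?_⟩
  have h0 := congrArg (Polynomial.eval 0) hc
  have h1 := congrArg (Polynomial.eval 1) hc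
  rw [Polynomial.eval_mul, Polynomial.eval_C, he₀, he₀] at h0
  rw [Polynomial.eval_mul, Polynomial.eval_C, he₁, he₁] at h1
  rw [map_sub, map_mul, map_mul, eval_C, eval_C, h0, h1]
  ring

/-- Lüroth's theorem for a subfield of transcendence degree one of `K(x₁, …, xₙ)` generated by
two elements. -/
theorem exists_adjoin_pair_eq {K σ M : Type*} [Field K] [Infinite K] [Field M]
    [Algebra (MvPolynomial σ K) M] [IsFractionRing (MvPolynomial σ K) M] [Algebra K M]
    [IsScalarTower K (MvPolynomial σ K) M] {t c : M} (ht : Transcendental K t)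
    (hc : IsAlgebraic K⟮t⟯ c) : ∃ θ : M, adjoin K {t, c} = K⟮θ⟯ := by
  obtain ⟨a, b, hb, rfl⟩ := IsFractionRing.div_surjective (MvPolynomial σ K) t
  obtain ⟨a', b', hb', rfl⟩ := IsFractionRing.div_surjective (MvPolynomial σ K) c
  rw [mem_nonZeroDivisors_iff_ne_zero] at hb hb'
  have hinj := IsFractionRing.injective (MvPolynomial σ K) M
  have hbM : algebraMap (MvPolynomial σ K) M b ≠ 0 := by rwa [Ne, map_eq_zero_iff _ hinj]
  have hbM' : algebraMap (MvPolynomial σ K) M b' ≠ 0 := by rwa [Ne, map_eq_zero_iff _ hinj]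
  have hw : b * b' ≠ 0 := mul_ne_zero hb hb'
  obtain ⟨e, hew, hea⟩ := exists_line (a := a * b') hw fun c hc => ht (by
    have : algebraMap (MvPolynomial σ K) M a / algebraMap (MvPolynomial σ K) M b
        = algebraMap K M c := by
      rw [IsScalarTower.algebraMap_apply K (MvPolynomial σ K) M, div_eq_iff hbM, algebraMap_eq,
        ← map_mul]
      congr 1
      apply mul_right_cancel₀ hb'
      rw [hc, mul_assoc]
    rw [this]
    exact isAlgebraic_algebraMap c)
  have hu₁ : ∀ y : Submonoid.powers (b * b'), IsUnit (IsScalarTower.toAlgHom K (MvPolynomial σ K) M y) := by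
    rintro ⟨_, n, rfl⟩
    rw [map_pow]
    exact (IsUnit.mk0 _ (by simpa using ⟨hb, hb'⟩)).pow n
  let e' : MvPolynomial σ K →ₐ[K] RatFunc K :=
    (IsScalarTower.toAlgHom K (Polynomial K) (RatFunc K)).comp e
  have hew' : e' (b * b') ≠ 0 := RatFunc.algebraMap_ne_zero hew
  have hu₂ : ∀ y : Submonoid.powers (b * b'), IsUnit (e' y) := by
    rintro ⟨_, n, rfl⟩
    rw [map_pow]
    exact (IsUnit.mk0 _ hew').pow n
  -- Inverting only the denominators gives a ring that contains both fractions and still maps to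
  -- K(X) by restriction to the line.
  let A := Localization.Away (b * b')
  let i₁ : A →ₐ[K] M := IsLocalization.liftAlgHom hu₁
  let i₂ : A →ₐ[K] RatFunc K := IsLocalization.liftAlgHom hu₂
  have hi₁ : ∀ p, i₁ (algebraMap (MvPolynomial σ K) A p) = algebraMap (MvPolynomial σ K) M p :=
    fun p => IsLocalization.lift_eq hu₁ p
  have hi₂ : ∀ p, i₂ (algebraMap (MvPolynomial σ K) A p) = e' p :=
    fun p => IsLocalization.lift_eq hu₂ p
  have hinj₁ : Function.Injective i₁ := by
    refine (IsLocalization.lift_injective_iff hu₁).mpr fun x y => ?_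
    have h1 : Function.Injective (algebraMap (MvPolynomial σ K) A) :=
      IsLocalization.injective A (powers_le_nonZeroDivisors_of_noZeroDivisors hw)
    exact ⟨fun h => congrArg _ (h1 h), fun h => congrArg _ (hinj h)⟩
  have hmk : ∀ p, ∃ z : A, z * algebraMap (MvPolynomial σ K) A (b * b')
      = algebraMap (MvPolynomial σ K) A p := fun p =>
    ⟨IsLocalization.mk' A p ⟨b * b', Submonoid.mem_powers _⟩, IsLocalization.mk'_spec A p _⟩
  obtain ⟨x, hx⟩ := hmk (a * b')
  obtain ⟨y, hy⟩ := hmk (a' * b)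
  have hx₁ : i₁ x = algebraMap (MvPolynomial σ K) M a / algebraMap (MvPolynomial σ K) M b := by
    have := congrArg i₁ hx
    rw [map_mul, hi₁, hi₁, map_mul, map_mul, ← mul_assoc] at this
    exact (eq_div_iff hbM).mpr (mul_right_cancel₀ hbM' this)
  have hy₁ : i₁ y = algebraMap (MvPolynomial σ K) M a' / algebraMap (MvPolynomial σ K) M b' := by
    have := congrArg i₁ hy
    rw [map_mul, hi₁, hi₁, map_mul, map_mul, mul_comm (algebraMap (MvPolynomial σ K) M b),
      ← mul_assoc] at this
    exact (eq_div_iff hbM').mpr (mul_right_cancel₀ hbM this)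
  have hx₂ : Transcendental K (i₂ x) := by
    apply RatFunc.transcendental_of_ne_C
    rintro ⟨c, hc⟩
    refine hea c ?_
    have := congrArg i₂ hx
    rw [map_mul, hi₂, hi₂, hc] at this
    apply RatFunc.algebraMap_injective K
    rw [map_mul (algebraMap (Polynomial K) (RatFunc K)) (Polynomial.C c), RatFunc.algebraMap_C]
    exact this.symm
  rw [← hx₁, ← hy₁] at hc ⊢
  obtain ⟨g⟩ := nonempty_algHom_adjoin_pair i₁ hinj₁ i₂ x y hc hx₂
  exact exists_adjoin_pair_eq_of_algHom g

end Luroth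

/-! ### Degrees and coprimality under substitution into forms -/

section Degrees

theorem homogeneousComponent_mul_of_totalDegree_le {σ R : Type*} [CommRing R]
    {p q : MvPolynomial σ R} {m n : ℕ} (hp : p.totalDegree ≤ m) (hq : q.totalDegree ≤ n) :
    homogeneousComponent (m + n) (p * q) = homogeneousComponent m p * homogeneousComponent n q := by
  classical
  ext e
  rw [coeff_homogeneousComponent, coeff_mul, coeff_mul]
  have hdeg : ∀ x ∈ Finset.HasAntidiagonal.antidiagonal e, x.1.degree + x.2.degree = e.degree := by
    intro x hx
    rw [← Finset.HasAntidiagonal.mem_antidiagonal.mp hx, map_add]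
  have hz : ∀ {r : MvPolynomial σ R} {k : ℕ}, r.totalDegree ≤ k → ∀ a : σ →₀ ℕ, k < a.degree →
      r.coeff a = 0 := by
    intro r k hr a ha
    apply coeff_eq_zero_of_totalDegree_lt
    rw [Finsupp.degree_apply] at ha
    exact hr.trans_lt ha
  split_ifs with h
  · refine Finset.sum_congr rfl fun x hx => ?_
    have h1 := hdeg x hx
    rw [coeff_homogeneousComponent, coeff_homogeneousComponent]
    rcases lt_trichotomy x.1.degree m with h2 | h2 | h2
    · rw [if_neg h2.ne, hz hq x.2 (by omega), mul_zero, zero_mul]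
    · rw [if_pos h2, if_pos (by omega)]
    · rw [if_neg h2.ne', hz hp x.1 h2, zero_mul, zero_mul]
  · symm
    refine Finset.sum_eq_zero fun x hx => ?_
    have h1 := hdeg x hx
    rw [coeff_homogeneousComponent, coeff_homogeneousComponent]
    split_ifs <;> first | omega | simp

theorem homogeneousComponent_pow_of_totalDegree_le {σ R : Type*} [CommRing R]
    {p : MvPolynomial σ R} {m : ℕ} (hp : p.totalDegree ≤ m) (i : ℕ) :
    homogeneousComponent (i * m) (p ^ i) = homogeneousComponent m p ^ i := by
  induction i with
  | zero => simp [homogeneousComponent_zero]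
  | succ i ih =>
    rw [pow_succ, pow_succ, add_mul, one_mul, homogeneousComponent_mul_of_totalDegree_le _ hp, ih]
    exact (totalDegree_pow p i).trans (Nat.mul_le_mul_left i hp)

theorem homogeneousComponent_aeval_homogenize {σ K : Type*} [Field K] {φ ψ : MvPolynomial σ K}
    {m : ℕ} (hφ : φ.totalDegree ≤ m) (hψ : ψ.totalDegree ≤ m) (p : Polynomial K) (d : ℕ) :
    homogeneousComponent (d * m) (aeval ![φ, ψ] (p.homogenize d))
      = aeval ![homogeneousComponent m φ, homogeneousComponent m ψ] (p.homogenize d) := by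
  rw [aeval_homogenize_eq_sum, aeval_homogenize_eq_sum, map_sum]
  refine Finset.sum_congr rfl fun i hi => ?_
  have hi : i ≤ d := Nat.lt_succ_iff.mp (Finset.mem_range.mp hi)
  obtain ⟨j, rfl⟩ := Nat.exists_eq_add_of_le hi
  rw [algebraMap_eq, homogeneousComponent_C_mul, Nat.add_sub_cancel_left, add_mul,
    homogeneousComponent_mul_of_totalDegree_le, homogeneousComponent_pow_of_totalDegree_le hφ,
    homogeneousComponent_pow_of_totalDegree_le hψ]
  · exact (totalDegree_pow _ _).trans (Nat.mul_le_mul_left _ hφ)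
  · exact (totalDegree_pow _ _).trans (Nat.mul_le_mul_left _ hψ)

theorem homogeneousComponent_totalDegree_ne_zero {σ R : Type*} [CommRing R] {p : MvPolynomial σ R}
    (hp : p ≠ 0) : homogeneousComponent p.totalDegree p ≠ 0 := by
  obtain ⟨m, hm, hmd⟩ := Finset.exists_mem_eq_sup p.support (support_nonempty.mpr hp)
    (fun s => s.sum fun _ e => e)
  refine ne_zero_iff.mpr ⟨m, ?_⟩
  rw [coeff_homogeneousComponent, if_pos]
  · exact mem_support_iff.mp hm
  · rw [Finsupp.degree_apply]; exact hmd.symm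

/-- Substituting `φ`, `ψ` into two coprime binary forms of degree `d` multiplies degrees by `d`. -/
theorem mul_max_totalDegree_le {σ K : Type*} [Field K] {φ ψ : MvPolynomial σ K}
    (h0 : φ ≠ 0 ∨ ψ ≠ 0)
    {p q : Polynomial K} (hpq : IsCoprime p q) {d : ℕ}
    (hd : max p.natDegree q.natDegree = d) (hd0 : d ≠ 0) :
    d * max φ.totalDegree ψ.totalDegree ≤
      max (aeval ![φ, ψ] (p.homogenize d)).totalDegree
        (aeval ![φ, ψ] (q.homogenize d)).totalDegree := by
  set m := max φ.totalDegree ψ.totalDegree with hm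
  rcases Nat.eq_zero_or_pos m with hm0 | hm0
  · simp [hm0]
  -- Otherwise the components of degree d · m of both values vanish. The degree-m components of φ
  -- and ψ are then a common zero of the two coprime forms, hence both zero, although one of them is
  -- a leading form.
  by_contra! hlt
  rw [max_lt_iff] at hlt
  have h1 := homogeneousComponent_aeval_homogenize (le_max_left φ.totalDegree ψ.totalDegree)
    (le_max_right φ.totalDegree ψ.totalDegree) p d
  have h2 := homogeneousComponent_aeval_homogenize (le_max_left φ.totalDegree ψ.totalDegree)
    (le_max_right φ.totalDegree ψ.totalDegree) q d
  rw [homogeneousComponent_eq_zero _ _ hlt.1] at h1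
  rw [homogeneousComponent_eq_zero _ _ hlt.2] at h2
  obtain ⟨h3, h4⟩ := eq_zero_of_aeval_homogenize_eq_zero hpq hd hd0 h1.symm h2.symm
  rw [← hm] at h3 h4
  rcases max_choice φ.totalDegree ψ.totalDegree with h | h
  · rw [← hm] at h
    rw [h] at h3 hm0
    exact homogeneousComponent_totalDegree_ne_zero (by rintro rfl; simp at hm0) h3
  · rw [← hm] at h
    rw [h] at h4 hm0
    exact homogeneousComponent_totalDegree_ne_zero (by rintro rfl; simp at hm0) h4

/-- Modulo an irreducible common divisor π, the classes of φ and ψ are a common zero of coprime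
forms in a domain. That zero is trivial, so π divides both φ and ψ. -/
theorem isRelPrime_aeval_homogenize {σ K : Type*} [Field K] {φ ψ : MvPolynomial σ K}
    (hrel : IsRelPrime φ ψ) {p q : Polynomial K} (hpq : IsCoprime p q) {d : ℕ}
    (hd : max p.natDegree q.natDegree = d) (hd0 : d ≠ 0) :
    IsRelPrime (aeval ![φ, ψ] (p.homogenize d)) (aeval ![φ, ψ] (q.homogenize d)) := by
  have key : ∀ I : Ideal (MvPolynomial σ K), I.IsPrime → aeval ![φ, ψ] (p.homogenize d) ∈ I →
      aeval ![φ, ψ] (q.homogenize d) ∈ I → φ ∈ I ∧ ψ ∈ I := by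
    intro I hI hp hq
    have h1 : ∀ s : Polynomial K, aeval ![φ, ψ] (s.homogenize d) ∈ I →
        aeval ![Ideal.Quotient.mk I φ, Ideal.Quotient.mk I ψ] (s.homogenize d) = 0 := by
      intro s hs
      rw [← Ideal.Quotient.eq_zero_iff_mem, aeval_homogenize_eq_sum, map_sum] at hs
      rw [aeval_homogenize_eq_sum, ← hs]
      refine Finset.sum_congr rfl fun i _ => ?_
      rw [map_mul, map_mul, map_pow, map_pow]
      rfl
    have := eq_zero_of_aeval_homogenize_eq_zero hpq hd hd0 (h1 p hp) (h1 q hq)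
    rwa [Ideal.Quotient.eq_zero_iff_mem, Ideal.Quotient.eq_zero_iff_mem] at this
  intro D hDp hDq
  by_contra hD
  rcases eq_or_ne D 0 with rfl | hD0
  · rw [zero_dvd_iff] at hDp hDq
    have := key ⊥ inferInstance (by rw [hDp]; exact zero_mem _) (by rw [hDq]; exact zero_mem _)
    rw [Ideal.mem_bot, Ideal.mem_bot] at this
    rw [this.1, this.2] at hrel
    exact not_isRelPrime_zero_zero hrel
  · obtain ⟨π, hπ, hπD⟩ := WfDvdMonoid.exists_irreducible_factor hD hD0
    have := key (Ideal.span {π}) ((Ideal.span_singleton_prime hπ.ne_zero).mpr hπ.prime)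
      (Ideal.mem_span_singleton.mpr (hπD.trans hDp)) (Ideal.mem_span_singleton.mpr (hπD.trans hDq))
    rw [Ideal.mem_span_singleton, Ideal.mem_span_singleton] at this
    exact hπ.not_isUnit (hrel this.1 this.2)

end Degrees

/-! ### Polynomials with vanishing derivatives -/

section PthPower

theorem coeff_mul_eq_zero_of_pderiv {σ K : Type*} [Field K] {f : MvPolynomial σ K} {i : σ}
    (h : pderiv i f = 0) (m : σ →₀ ℕ) : f.coeff m * (m i : K) = 0 := by
  rcases Nat.eq_zero_or_pos (m i) with h0 | h0
  · simp [h0]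
  · have h1 := coeff_pderiv (i := i) f (m - Finsupp.single i 1)
    have h2 : m - Finsupp.single i 1 + Finsupp.single i 1 = m :=
      tsub_add_cancel_of_le (Finsupp.single_le_iff.mpr h0)
    rw [h, h2, coeff_zero] at h1
    have h3 : (m - Finsupp.single i 1 : σ →₀ ℕ) i + 1 = m i := by
      simp; omega
    rw [← h3]
    push_cast
    exact h1.symm

theorem totalDegree_eq_zero_of_pderiv {σ K : Type*} [Field K] [CharZero K] {f : MvPolynomial σ K}
    (h : ∀ i, pderiv i f = 0) : f.totalDegree = 0 := by
  rw [totalDegree_eq_zero_iff]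
  intro m hm i
  have := coeff_mul_eq_zero_of_pderiv (h i) m
  simpa [mem_support_iff.mp hm] using this

/-- Only monomials with all exponents divisible by p survive, and K contains the p-th roots of their
coefficients. -/
theorem exists_pow_eq_of_pderiv {σ K : Type*} [Field K] [IsAlgClosed K] (p : ℕ) [Fact p.Prime]
    [CharP K p] {f : MvPolynomial σ K} (h : ∀ i, pderiv i f = 0) : ∃ g, g ^ p = f := by
  have hroot : ∀ c : K, ∃ b, b ^ p = c := fun c =>
    IsAlgClosed.exists_pow_nat_eq c (Fact.out : p.Prime).pos
  choose b hb using hroot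
  refine ⟨∑ m ∈ f.support, monomial (m.mapRange (· / p) (Nat.zero_div p)) (b (f.coeff m)), ?_⟩
  rw [sum_pow_char]
  conv_rhs => rw [f.as_sum]
  refine Finset.sum_congr rfl fun m hm => ?_
  have hpm : p • m.mapRange (· / p) (Nat.zero_div p) = m := by
    ext i
    have := coeff_mul_eq_zero_of_pderiv (h i) m
    rw [mul_eq_zero, or_iff_right (mem_support_iff.mp hm), CharP.cast_eq_zero_iff K p] at this
    simp [Nat.mul_div_cancel' this]
  rw [monomial_pow, hb, hpm]

end PthPower

/-! ### The Bertini–Krull theorem for pencils -/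

section BertiniKrull

open IntermediateField

theorem totalDegree_pow_of_isDomain {σ R : Type*} [CommRing R] [IsDomain R]
    (q : MvPolynomial σ R) (k : ℕ) : (q ^ k).totalDegree = k * q.totalDegree := by
  rcases eq_or_ne q 0 with rfl | hq
  · rcases eq_or_ne k 0 with rfl | hk
    · simp
    · simp [zero_pow hk]
  · induction k with
    | zero => simp
    | succ k ih =>
      rw [pow_succ, totalDegree_mul_of_isDomain (pow_ne_zero _ hq) hq, ih, add_mul, one_mul]

theorem totalDegree_C_mul {σ R : Type*} [CommRing R] [IsDomain R] {c : R} (hc : c ≠ 0)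
    (q : MvPolynomial σ R) : (C c * q).totalDegree = q.totalDegree := by
  rcases eq_or_ne q 0 with rfl | hq
  · simp
  · rw [totalDegree_mul_of_isDomain (by simpa using hc) hq, totalDegree_C, zero_add]

theorem algebraMap_add_X_mul_eq_zero {K : Type*} [Field K] {a b : K}
    (h : algebraMap K (RatFunc K) a + RatFunc.X * algebraMap K (RatFunc K) b = 0) :
    a = 0 ∧ b = 0 := by
  have h1 : algebraMap (Polynomial K) (RatFunc K)
      (Polynomial.C a + Polynomial.X * Polynomial.C b) = 0 := by
    rw [map_add, map_mul, RatFunc.algebraMap_C, RatFunc.algebraMap_C, RatFunc.algebraMap_X]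
    exact h
  rw [map_eq_zero_iff _ (RatFunc.algebraMap_injective K)] at h1
  have h2 := congrArg (Polynomial.coeff · 0) h1
  have h3 := congrArg (Polynomial.coeff · 1) h1
  simp [Polynomial.coeff_C] at h2 h3
  exact ⟨h2, h3⟩

theorem pencil_eq_zero {σ K : Type*} [Field K] {φ ψ : MvPolynomial σ K}
    (h : map (algebraMap K (RatFunc K)) φ + C RatFunc.X * map (algebraMap K (RatFunc K)) ψ = 0) :
    φ = 0 ∧ ψ = 0 := by
  have key : ∀ m, φ.coeff m = 0 ∧ ψ.coeff m = 0 := by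
    intro m
    have := congrArg (coeff m) h
    rw [coeff_add, coeff_C_mul, coeff_map, coeff_map, coeff_zero] at this
    exact algebraMap_add_X_mul_eq_zero this
  exact ⟨MvPolynomial.ext _ _ fun m => (key m).1, MvPolynomial.ext _ _ fun m => (key m).2⟩

/-- If the pencil `φ + λ ψ` is reducible over the algebraic closure of `K(λ)`, then all partial
derivatives of `φ` and `ψ` vanish, or `K(φ/ψ)` is not algebraically closed in `K(x)`. -/
theorem pderiv_eq_zero_or_exists_isAlgebraic {σ K M : Type*} [Field K] [IsAlgClosed K]
    [Field M] [Algebra (MvPolynomial σ K) M] [IsFractionRing (MvPolynomial σ K) M] [Algebra K M]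
    [IsScalarTower K (MvPolynomial σ K) M]
    {φ ψ : MvPolynomial σ K} (hrel : IsRelPrime φ ψ) (hψ : ψ ≠ 0) {t : M}
    (ht : t = -(algebraMap (MvPolynomial σ K) M φ / algebraMap (MvPolynomial σ K) M ψ))
    (htr : Transcendental K t)
    (hirr : ¬ Irreducible
      (map (algebraMap K (AlgebraicClosure (RatFunc K))) φ
        + C (algebraMap (RatFunc K) (AlgebraicClosure (RatFunc K)) RatFunc.X)
          * map (algebraMap K (AlgebraicClosure (RatFunc K))) ψ)) :
    (∀ i, pderiv i φ = 0 ∧ pderiv i ψ = 0) ∨ ∃ c : M, IsAlgebraic K⟮t⟯ c ∧ c ∉ K⟮t⟯ := by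
  let e : RatFunc K ≃ₐ[K] K⟮t⟯ := RatFunc.algEquivOfTranscendental t htr
  have het : (e RatFunc.X : M) = t := by
    simp only [e, ← RatFunc.algebraMap_X, RatFunc.algEquivOfTranscendental_algebraMap]
    simp
  let _ : Algebra (RatFunc K) K⟮t⟯ := e.toRingHom.toAlgebra
  -- K(x) becomes an extension of K(λ) with λ acting as t, so that the coordinates satisfy φ + λψ =
  -- 0.
  let _ : Algebra (RatFunc K) M := ((algebraMap K⟮t⟯ M).comp e.toRingHom).toAlgebra
  have : IsScalarTower (RatFunc K) K⟮t⟯ M := IsScalarTower.of_algebraMap_eq fun _ => rfl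
  have : IsScalarTower K (RatFunc K) M := IsScalarTower.of_algebraMap_eq fun c => by
    change _ = ((e (algebraMap K (RatFunc K) c) : K⟮t⟯) : M)
    rw [e.commutes]; rfl
  let _ : Algebra (AlgebraicClosure (RatFunc K)) (AlgebraicClosure M) :=
    (IsAlgClosed.lift (R := RatFunc K) (S := AlgebraicClosure (RatFunc K))
      (M := AlgebraicClosure M)).toRingHom.toAlgebra
  have : IsScalarTower (RatFunc K) (AlgebraicClosure (RatFunc K)) (AlgebraicClosure M) :=
    IsScalarTower.of_algebraMap_eq fun c =>
      ((IsAlgClosed.lift (R := RatFunc K) (S := AlgebraicClosure (RatFunc K))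
        (M := AlgebraicClosure M)).commutes c).symm
  have htX : algebraMap (RatFunc K) M RatFunc.X = t := het
  set f := map (algebraMap K (RatFunc K)) φ + C RatFunc.X * map (algebraMap K (RatFunc K)) ψ
    with hf
  have hf0 : f ≠ 0 := fun h => hψ (pencil_eq_zero h).2
  have hψM : algebraMap (MvPolynomial σ K) M ψ ≠ 0 := by
    rwa [Ne, map_eq_zero_iff _ (IsFractionRing.injective (MvPolynomial σ K) M)]
  have hmapf : map (algebraMap (RatFunc K) (AlgebraicClosure (RatFunc K))) f =
      map (algebraMap K (AlgebraicClosure (RatFunc K))) φ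
        + C (algebraMap (RatFunc K) (AlgebraicClosure (RatFunc K)) RatFunc.X)
          * map (algebraMap K (AlgebraicClosure (RatFunc K))) ψ := by
    rw [hf, map_add, map_mul, map_C, MvPolynomial.map_map, MvPolynomial.map_map, ← IsScalarTower.algebraMap_eq]
  have hev : aeval (fun i => algebraMap (MvPolynomial σ K) M (X i)) f = 0 := by
    have : (aeval fun i => algebraMap (MvPolynomial σ K) M (X i))
        = IsScalarTower.toAlgHom K (MvPolynomial σ K) M := by ext i; simp
    rw [hf, map_add, map_mul, aeval_map_algebraMap, aeval_map_algebraMap, aeval_C, htX, this]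
    simp only [IsScalarTower.coe_toAlgHom', ht]
    field_simp
    ring
  by_contra! hcon
  obtain ⟨⟨i, hi⟩, hc⟩ := hcon
  rcases irreducible_map_or_pderiv_eq_zero (k := AlgebraicClosure (RatFunc K))
    (Ω := AlgebraicClosure M) (fun i => algebraMap (MvPolynomial σ K) M (X i)) hf0 hev
    (pencil_dvd hrel hψ (htX.trans ht)) (fun c hcalg => by
      obtain ⟨y, hy⟩ : ∃ y : K⟮t⟯, (y : M) = c :=
        ⟨⟨c, hc c (hcalg.extendScalars (algebraMap (RatFunc K) K⟮t⟯).injective)⟩, rfl⟩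
      exact ⟨e.symm y, by
        change ((e (e.symm y) : K⟮t⟯) : M) = c
        rw [e.apply_symm_apply, hy]⟩) with h | h
  · rw [hmapf] at h; exact hirr h
  · have h1 := h i
    rw [hf, map_add, pderiv_C_mul, pderiv_map, pderiv_map] at h1
    exact hi (pencil_eq_zero h1).1 (pencil_eq_zero h1).2

/-- Write t = r(θ)/s(θ) and θ = φ'/ψ' in lowest terms. Homogenising r and s at (φ', ψ') gives t in
lowest terms, which agrees with -φ/ψ up to a constant by unique factorisation. -/
theorem exists_comp_of_mem_adjoin {σ K M : Type*} [Field K]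
    [Field M] [Algebra (MvPolynomial σ K) M] [IsFractionRing (MvPolynomial σ K) M] [Algebra K M]
    [IsScalarTower K (MvPolynomial σ K) M]
    {φ ψ : MvPolynomial σ K} (hrel : IsRelPrime φ ψ) (hψ : ψ ≠ 0)
    (hdeg : 0 < max φ.totalDegree ψ.totalDegree) {t θ : M}
    (ht : t = -(algebraMap (MvPolynomial σ K) M φ / algebraMap (MvPolynomial σ K) M ψ))
    (htr : Transcendental K t) (htθ : t ∈ K⟮θ⟯) (hθt : θ ∉ K⟮t⟯) :
    ∃ (φ' ψ' : MvPolynomial σ K) (d : ℕ) (H₁ H₂ : MvPolynomial (Fin 2) K), IsRelPrime φ' ψ' ∧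
      max φ'.totalDegree ψ'.totalDegree < max φ.totalDegree ψ.totalDegree ∧
      H₁.IsHomogeneous d ∧ H₂.IsHomogeneous d ∧
      φ = aeval ![φ', ψ'] H₁ ∧ ψ = aeval ![φ', ψ'] H₂ := by
  have hinj := IsFractionRing.injective (MvPolynomial σ K) M
  obtain ⟨r₀, s₀, hrs₀⟩ := (mem_adjoin_simple_iff K t).mp htθ
  have ht0 : t ≠ 0 := by
    rintro rfl; exact htr isAlgebraic_zero
  have hs₀ : Polynomial.aeval θ s₀ ≠ 0 := by
    intro h; rw [h, div_zero] at hrs₀; exact ht0 hrs₀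
  obtain ⟨r, s, g, hcop, hr, hs⟩ : ∃ r s g : Polynomial K, IsCoprime r s ∧ r₀ = g * r ∧ s₀ = g * s := by
    classical
    obtain ⟨r, s, hr, hs, hu⟩ := extract_gcd r₀ s₀
    refine ⟨r, s, _, ?_, hr, hs⟩
    rwa [← EuclideanDomain.gcd_isUnit_iff, ← (gcd_isUnit_iff r s).trans (EuclideanDomain.gcd_isUnit_iff).symm]
  have hgθ : Polynomial.aeval θ g ≠ 0 := by
    intro h; rw [hs, map_mul, h, zero_mul] at hs₀; exact hs₀ rfl
  have hsθ : Polynomial.aeval θ s ≠ 0 := by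
    intro h; rw [hs, map_mul, h, mul_zero] at hs₀; exact hs₀ rfl
  have hrs : t * Polynomial.aeval θ s = Polynomial.aeval θ r := by
    rw [hrs₀, hr, hs, map_mul, map_mul, mul_div_mul_left _ _ hgθ, div_mul_cancel₀ _ hsθ]
  obtain ⟨d, hd⟩ : ∃ d, max r.natDegree s.natDegree = d := ⟨_, rfl⟩
  have hr_le : r.natDegree ≤ d := hd ▸ le_max_left _ _
  have hs_le : s.natDegree ≤ d := hd ▸ le_max_right _ _
  -- For d ≤ 1 the relation between t and θ is a fractional linear one, which can be solved for θ in
  -- K(t).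
  have hd2 : 2 ≤ d := by
    by_contra! hlt
    have hr1 := Polynomial.exists_eq_X_add_C_of_natDegree_le_one (p := r) (by omega)
    have hs1 := Polynomial.exists_eq_X_add_C_of_natDegree_le_one (p := s) (by omega)
    obtain ⟨a, b, hab⟩ := hr1
    obtain ⟨a', b', hab'⟩ := hs1
    rw [hab, hab'] at hrs
    simp only [map_add, map_mul, Polynomial.aeval_C, Polynomial.aeval_X] at hrs
    have h1 : (t * algebraMap K M a' - algebraMap K M a) * θ
        = algebraMap K M b - t * algebraMap K M b' := by linear_combination hrs
    have hmemt : t ∈ K⟮t⟯ := mem_adjoin_simple_self K t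
    have hmem : ∀ x y : K, t * algebraMap K M x - algebraMap K M y ∈ K⟮t⟯ := fun x y =>
      sub_mem (mul_mem hmemt (_root_.algebraMap_mem _ x)) (_root_.algebraMap_mem _ y)
    have hlin : ∀ x y : K, t * algebraMap K M x - algebraMap K M y = 0 → x = 0 ∧ y = 0 := by
      intro x y hxy
      have hx : x = 0 := by
        by_contra hx
        refine htr ?_
        have : t = algebraMap K M (y / x) := by
          rw [map_div₀, eq_div_iff (by simpa using hx)]
          exact sub_eq_zero.mp hxy
        rw [this]; exact isAlgebraic_algebraMap _
      subst hx
      simpa using hxy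
    by_cases h2 : t * algebraMap K M a' - algebraMap K M a = 0
    · obtain ⟨rfl, rfl⟩ := hlin _ _ h2
      rw [h2, zero_mul] at h1
      have h3 : t * algebraMap K M b' - algebraMap K M b = 0 := by
        linear_combination h1
      obtain ⟨rfl, rfl⟩ := hlin _ _ h3
      rw [hab'] at hsθ
      simp at hsθ
    · apply hθt
      rw [eq_div_of_mul_eq h2 ((mul_comm _ _).trans h1)]
      refine div_mem ?_ (hmem _ _)
      rw [← neg_sub]
      exact neg_mem (hmem _ _)
  have hd0 : d ≠ 0 := by omega
  obtain ⟨φ', ψ', hrel', hθ⟩ := IsFractionRing.exists_reduced_fraction (A := MvPolynomial σ K) θ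
  have hψ' : (ψ' : MvPolynomial σ K) ≠ 0 := nonZeroDivisors.coe_ne_zero ψ'
  have hψM : algebraMap (MvPolynomial σ K) M ψ ≠ 0 := by rwa [Ne, map_eq_zero_iff _ hinj]
  have hψM' : algebraMap (MvPolynomial σ K) M ψ' ≠ 0 := by rwa [Ne, map_eq_zero_iff _ hinj]
  rw [IsFractionRing.mk'_eq_div] at hθ
  have hval : ∀ p : Polynomial K, p.natDegree ≤ d →
      algebraMap (MvPolynomial σ K) M (aeval ![φ', (ψ' : MvPolynomial σ K)] (p.homogenize d))
        = algebraMap (MvPolynomial σ K) M ψ' ^ d * Polynomial.aeval θ p := by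
    intro p hp
    rw [← hθ, ← aeval_homogenize_of_ne_zero p hp _ hψM', aeval_homogenize_eq_sum,
      aeval_homogenize_eq_sum, map_sum]
    refine Finset.sum_congr rfl fun i _ => ?_
    rw [map_mul, map_mul, map_pow, map_pow, ← IsScalarTower.algebraMap_apply]
  set R₁ := aeval ![φ', (ψ' : MvPolynomial σ K)] (r.homogenize d) with hR₁
  set R₂ := aeval ![φ', (ψ' : MvPolynomial σ K)] (s.homogenize d) with hR₂
  have hRrel : IsRelPrime R₁ R₂ := isRelPrime_aeval_homogenize hrel' hcop hd hd0
  have hR₁0 : R₁ ≠ 0 := by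
    intro h
    have := hval r hr_le
    rw [← hR₁, h, map_zero, ← hrs] at this
    exact mul_ne_zero (pow_ne_zero _ hψM') (mul_ne_zero ht0 hsθ) this.symm
  have hcross : R₁ * ψ = -φ * R₂ := by
    apply hinj
    rw [map_mul, map_mul, map_neg, hval r hr_le, hval s hs_le, ← hrs, ht]
    field_simp
  have h1 : R₁ ∣ φ := hRrel.dvd_of_dvd_mul_right (by
    rw [← dvd_neg, ← neg_mul, ← hcross]; exact dvd_mul_right _ _)
  have h2 : φ ∣ R₁ := hrel.dvd_of_dvd_mul_right (by
    rw [hcross, neg_mul, dvd_neg]; exact dvd_mul_right _ _)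
  obtain ⟨u, hu⟩ := associated_of_dvd_dvd h1 h2
  obtain ⟨c, -, hc⟩ := isUnit_iff_eq_C_of_isReduced.mp u.isUnit
  have hφ : φ = C c * R₁ := by rw [← hu, hc, mul_comm]
  have hψ2 : ψ = -C c * R₂ := by
    apply mul_left_cancel₀ hR₁0
    rw [hcross, hφ]; ring
  have hdeg' := mul_max_totalDegree_le (Or.inr hψ' : φ' ≠ 0 ∨ _) hcop hd hd0
  rw [← hR₁, ← hR₂] at hdeg'
  have hdle : max R₁.totalDegree R₂.totalDegree ≤ max φ.totalDegree ψ.totalDegree := by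
    have hc0 : c ≠ 0 := by
      rintro rfl
      rw [hφ, hψ2] at hdeg; simp at hdeg
    rw [hφ, hψ2, neg_mul, totalDegree_neg, totalDegree_C_mul hc0, totalDegree_C_mul hc0]
  refine ⟨φ', ψ', d, C c * r.homogenize d, -C c * s.homogenize d, hrel', ?_, ?_, ?_, ?_, ?_⟩
  -- The old degree is at least d times the new one, and d ≥ 2; a new degree of 0 is below the
  -- positive old one.
  · rcases Nat.eq_zero_or_pos (max φ'.totalDegree (ψ' : MvPolynomial σ K).totalDegree) with h | h
    · rwa [h]
    · nlinarith
  · simpa using (isHomogeneous_C (Fin 2) c).mul (Polynomial.isHomogeneous_homogenize r)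
  · rw [← C_neg]
    simpa using (isHomogeneous_C (Fin 2) (-c)).mul (Polynomial.isHomogeneous_homogenize s)
  · rw [map_mul, aeval_C, ← hR₁, hφ]; rfl
  · rw [map_mul, map_neg, aeval_C, ← hR₂, hψ2]; rfl

/-- **Bertini–Krull** for pencils: if `φ + λ ψ` is reducible over the algebraic closure of `K(λ)`,
then `φ` and `ψ` are forms of the same degree in two polynomials of smaller degree. -/
theorem exists_comp_of_not_irreducible {σ K : Type*} [Field K] [IsAlgClosed K]
    {φ ψ : MvPolynomial σ K} (hrel : IsRelPrime φ ψ)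
    (hdeg : 0 < max φ.totalDegree ψ.totalDegree)
    (hirr : ¬ Irreducible
      (map (algebraMap K (AlgebraicClosure (RatFunc K))) φ
        + C (algebraMap (RatFunc K) (AlgebraicClosure (RatFunc K)) RatFunc.X)
          * map (algebraMap K (AlgebraicClosure (RatFunc K))) ψ)) :
    ∃ (φ' ψ' : MvPolynomial σ K) (d : ℕ) (H₁ H₂ : MvPolynomial (Fin 2) K), IsRelPrime φ' ψ' ∧
      max φ'.totalDegree ψ'.totalDegree < max φ.totalDegree ψ.totalDegree ∧
      H₁.IsHomogeneous d ∧ H₂.IsHomogeneous d ∧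
      φ = aeval ![φ', ψ'] H₁ ∧ ψ = aeval ![φ', ψ'] H₂ := by
  have hψ : ψ ≠ 0 := by
    rintro rfl
    obtain ⟨c, -, rfl⟩ := isUnit_iff_eq_C_of_isReduced.mp (isRelPrime_zero_right.mp hrel)
    simp at hdeg
  let M := FractionRing (MvPolynomial σ K)
  have htr := transcendental_ratio (M := M) hrel hψ hdeg
  rcases pderiv_eq_zero_or_exists_isAlgebraic (M := M) hrel hψ rfl htr hirr with h | ⟨c, hc, hct⟩
  -- Vanishing derivatives: in characteristic p the pencil is composed with the forms uᵖ and vᵖ; in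
  -- characteristic zero φ and ψ would be constant.
  · obtain ⟨p, hp⟩ := CharP.exists K
    rcases CharP.char_is_prime_or_zero K p with hprime | rfl
    · have : Fact p.Prime := ⟨hprime⟩
      obtain ⟨φ', hφ'⟩ := exists_pow_eq_of_pderiv p fun i => (h i).1
      obtain ⟨ψ', hψ'⟩ := exists_pow_eq_of_pderiv p fun i => (h i).2
      refine ⟨φ', ψ', p, X 0 ^ p, X 1 ^ p, ?_, ?_, ?_, ?_, ?_, ?_⟩
      · intro D h1 h2
        exact hrel (hφ' ▸ dvd_pow h1 hprime.ne_zero) (hψ' ▸ dvd_pow h2 hprime.ne_zero)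
      · rw [← hφ', ← hψ', totalDegree_pow_of_isDomain, totalDegree_pow_of_isDomain,
          Nat.mul_max_mul_left] at hdeg ⊢
        have := hprime.two_le
        have := Nat.pos_of_mul_pos_left hdeg
        nlinarith
      · simpa using (isHomogeneous_X K (0 : Fin 2)).pow p
      · simpa using (isHomogeneous_X K (1 : Fin 2)).pow p
      · simp [hφ']
      · simp [hψ']
    · have : CharZero K := CharP.charP_to_charZero K
      rw [totalDegree_eq_zero_of_pderiv fun i => (h i).1,
        totalDegree_eq_zero_of_pderiv fun i => (h i).2] at hdeg
      simp at hdeg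
  · obtain ⟨θ, hθ⟩ := exists_adjoin_pair_eq (σ := σ) htr hc
    refine exists_comp_of_mem_adjoin (θ := θ) hrel hψ hdeg rfl htr ?_ fun hθt => hct ?_
    · rw [← hθ]; exact subset_adjoin _ _ (by simp)
    · have h1 : c ∈ K⟮θ⟯ := by rw [← hθ]; exact subset_adjoin _ _ (by simp)
      exact adjoin_simple_le_iff.mpr hθt h1

end BertiniKrull

/-! ### Irreducibility under extension of an algebraically closed field -/

section BaseChange

theorem isUnit_mvPolynomial_map_iff {σ k L : Type*} [Field k] [Field L] (f : k →+* L) (p : MvPolynomial σ k) :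
    IsUnit (map f p) ↔ IsUnit p := by
  refine ⟨fun h => ?_, fun h => h.map _⟩
  obtain ⟨c, hc, h⟩ := isUnit_iff_eq_C_of_isReduced.mp h
  have hp : p = C (p.coeff 0) := by
    ext m
    apply f.injective
    have h0 := congrArg (coeff 0) h
    have h1 := congrArg (coeff m) h
    classical
    rw [coeff_map, coeff_C] at h0 h1
    rw [coeff_C, h1]
    split_ifs with hm
    · rw [h0, if_pos rfl]
    · rw [map_zero]
  refine isUnit_iff_eq_C_of_isReduced.mpr ⟨p.coeff 0, ?_, hp⟩
  rw [isUnit_iff_ne_zero]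
  intro h0
  rw [h0, C_0] at hp
  rw [hp, map_zero, eq_comm, C_eq_zero] at h
  exact hc.ne_zero h

theorem irreducible_of_map {σ k L : Type*} [Field k] [Field L] (f : k →+* L)
    {p : MvPolynomial σ k} (h : Irreducible (map f p)) : Irreducible p := by
  refine ⟨fun hp => h.not_isUnit (hp.map _), fun a b hab => ?_⟩
  rw [hab, map_mul] at h
  rw [← isUnit_mvPolynomial_map_iff f a, ← isUnit_mvPolynomial_map_iff f b]
  exact h.isUnit_or_isUnit rfl

/-- A finitely generated nontrivial algebra over an algebraically closed field has a rational
point. -/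
theorem nonempty_algHom_of_finiteType {k A : Type*} [Field k] [IsAlgClosed k] [CommRing A]
    [Nontrivial A] [Algebra k A] [Algebra.FiniteType k A] : Nonempty (A →ₐ[k] k) := by
  obtain ⟨m, hm⟩ := Ideal.exists_maximal A
  let _ : Field (A ⧸ m) := Ideal.Quotient.field m
  have : Module.Finite k (A ⧸ m) := finite_of_finite_type_of_isJacobsonRing k (A ⧸ m)
  have hbij := IsAlgClosed.algebraMap_bijective_of_isIntegral (k := k) (K := A ⧸ m)
  let e : k ≃ₐ[k] A ⧸ m := AlgEquiv.ofBijective (Algebra.ofId k (A ⧸ m)) hbij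
  exact ⟨e.symm.toAlgHom.comp (Ideal.Quotient.mkₐ k m)⟩

theorem exists_coeff_ne_zero_of_not_isUnit {σ k : Type*} [Field k] {p : MvPolynomial σ k}
    (h0 : p ≠ 0) (h : ¬ IsUnit p) : ∃ m ≠ 0, p.coeff m ≠ 0 := by
  by_contra! hc
  have hp : p = C (p.coeff 0) := by
    classical
    ext m
    rw [coeff_C]
    split_ifs with hm
    · rw [hm]
    · exact hc m (Ne.symm hm)
  refine h (isUnit_iff_eq_C_of_isReduced.mpr ⟨_, isUnit_iff_ne_zero.mpr fun hz => h0 ?_, hp⟩)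
  rw [hp, hz, C_0]

/-- Irreducible polynomials over an algebraically closed field are absolutely irreducible. -/
theorem irreducible_map_of_isAlgClosed {σ k L : Type*} [Field k] [IsAlgClosed k] [Field L]
    [Algebra k L] {f : MvPolynomial σ k} (hf : Irreducible f) :
    Irreducible (map (algebraMap k L) f) := by
  classical
  refine ⟨fun h => hf.not_isUnit ((isUnit_mvPolynomial_map_iff _ _).mp h), fun g h hgh => ?_⟩
  by_contra! hcon
  have hF0 : map (algebraMap k L) f ≠ 0 := by
    rw [Ne, map_eq_zero_iff _ (map_injective _ (algebraMap k L).injective)]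
    exact hf.ne_zero
  have hg0 : g ≠ 0 := by rintro rfl; rw [zero_mul] at hgh; exact hF0 hgh
  have hh0 : h ≠ 0 := by rintro rfl; rw [mul_zero] at hgh; exact hF0 hgh
  obtain ⟨m, hm, hgm⟩ := exists_coeff_ne_zero_of_not_isUnit hg0 hcon.1
  obtain ⟨n, hn, hhn⟩ := exists_coeff_ne_zero_of_not_isUnit hh0 hcon.2
  -- A factorisation over L lives over the finitely generated k-algebra A. Adjoining the inverse of
  -- one nonconstant coefficient from each factor keeps both factors nonconstant after
  -- specialisation at a k-point of A.
  let S : Finset L := g.support.image g.coeff ∪ h.support.image h.coeff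
    ∪ {(g.coeff m * h.coeff n)⁻¹}
  let A := Algebra.adjoin k (S : Set L)
  have : Algebra.FiniteType k A := A.fg_iff_finiteType.mp (Subalgebra.fg_adjoin_finset S)
  obtain ⟨π⟩ := nonempty_algHom_of_finiteType (k := k) (A := A)
  have hS : ∀ x ∈ S, x ∈ A := fun x hx => Algebra.subset_adjoin hx
  have hlift : ∀ p : MvPolynomial σ L, (∀ j, p.coeff j ∈ A) →
      ∃ p' : MvPolynomial σ A, map (algebraMap A L) p' = p := by
    intro p hp
    refine ⟨∑ j ∈ p.support, monomial j ⟨p.coeff j, hp j⟩, ?_⟩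
    rw [map_sum]
    conv_rhs => rw [p.as_sum]
    refine Finset.sum_congr rfl fun j _ => ?_
    rw [map_monomial]; rfl
  have hmem : ∀ p : MvPolynomial σ L, p.support.image p.coeff ⊆ S → ∀ j, p.coeff j ∈ A := by
    intro p hp j
    by_cases hj : p.coeff j = 0
    · rw [hj]; exact zero_mem _
    · exact hS _ (hp (Finset.mem_image_of_mem _ (mem_support_iff.mpr hj)))
  obtain ⟨g', hg'⟩ := hlift g (hmem g (Finset.subset_union_left.trans Finset.subset_union_left))
  obtain ⟨h', hh'⟩ := hlift h (hmem h (Finset.subset_union_right.trans Finset.subset_union_left))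
  have hinj : Function.Injective (algebraMap A L) := Subtype.val_injective
  have hfA : map (algebraMap k A) f = g' * h' := by
    apply map_injective _ hinj
    rw [map_mul, hg', hh', map_map, ← IsScalarTower.algebraMap_eq, hgh]
  have hfk : f = map (π : A →+* k) g' * map (π : A →+* k) h' := by
    rw [← map_mul, ← hfA, map_map]
    have : (π : A →+* k).comp (algebraMap k A) = RingHom.id k := by ext x; simp
    rw [this, map_id]
  have hunit : g'.coeff m * h'.coeff n * ⟨(g.coeff m * h.coeff n)⁻¹, hS _ (by simp [S])⟩ = 1 := by
    apply hinj
    rw [map_mul, map_mul, ← coeff_map, ← coeff_map, hg', hh']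
    exact mul_inv_cancel₀ (mul_ne_zero hgm hhn)
  have hπ := congrArg π hunit
  rw [map_mul, map_mul, map_one] at hπ
  rcases hf.isUnit_or_isUnit hfk with hu | hu <;>
    obtain ⟨c, -, hc⟩ := isUnit_iff_eq_C_of_isReduced.mp hu
  · have h1 := congrArg (coeff m) hc
    rw [coeff_map, coeff_C, if_neg hm.symm] at h1
    have h1 : π (g'.coeff m) = 0 := h1
    rw [h1, zero_mul, zero_mul] at hπ
    exact zero_ne_one hπ
  · have h1 := congrArg (coeff n) hc
    rw [coeff_map, coeff_C, if_neg hn.symm] at h1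
    have h1 : π (h'.coeff n) = 0 := h1
    rw [h1, mul_zero, zero_mul] at hπ
    exact zero_ne_one hπ

/-- Irreducibility of the generic member of a pencil may be tested on any transcendental member
over an algebraically closed field. -/
theorem irreducible_pencil_iff {σ K L : Type*} [Field K] [Field L] [IsAlgClosed L] [Algebra K L]
    {τ : L} (hτ : Transcendental K τ) (φ ψ : MvPolynomial σ K) :
    Irreducible (map (algebraMap K (AlgebraicClosure (RatFunc K))) φ
        + C (algebraMap (RatFunc K) (AlgebraicClosure (RatFunc K)) RatFunc.X)
          * map (algebraMap K (AlgebraicClosure (RatFunc K))) ψ) ↔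
      Irreducible (map (algebraMap K L) φ + C τ * map (algebraMap K L) ψ) := by
  let i : RatFunc K →ₐ[K] L := (IntermediateField.val _).comp
    (RatFunc.algEquivOfTranscendental τ hτ).toAlgHom
  have hi : i RatFunc.X = τ := by
    change ((RatFunc.algEquivOfTranscendental τ hτ RatFunc.X :
      IntermediateField.adjoin K {τ}) : L) = τ
    rw [← RatFunc.algebraMap_X, RatFunc.algEquivOfTranscendental_algebraMap]
    simp
  let _ : Algebra (RatFunc K) L := i.toRingHom.toAlgebra
  let j : AlgebraicClosure (RatFunc K) →ₐ[RatFunc K] L := IsAlgClosed.lift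
  let _ : Algebra (AlgebraicClosure (RatFunc K)) L := j.toRingHom.toAlgebra
  have hj : (algebraMap (AlgebraicClosure (RatFunc K)) L).comp
      (algebraMap K (AlgebraicClosure (RatFunc K))) = algebraMap K L := by
    ext c
    rw [RingHom.comp_apply, IsScalarTower.algebraMap_apply K (RatFunc K)]
    exact (j.commutes _).trans (i.commutes c)
  have hmap : map (algebraMap (AlgebraicClosure (RatFunc K)) L)
      (map (algebraMap K (AlgebraicClosure (RatFunc K))) φ
        + C (algebraMap (RatFunc K) (AlgebraicClosure (RatFunc K)) RatFunc.X)
          * map (algebraMap K (AlgebraicClosure (RatFunc K))) ψ)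
      = map (algebraMap K L) φ + C τ * map (algebraMap K L) ψ := by
    rw [map_add, map_mul, map_C, map_map, map_map, hj]
    congr 3
    exact (j.commutes _).trans hi
  rw [← hmap]
  exact ⟨irreducible_map_of_isAlgClosed, irreducible_of_map _⟩

end BaseChange

/-! ### Counting irreducible factors -/

section FactorCount

open UniqueFactorizationMonoid

variable {R : Type*} [CommRing R] [UniqueFactorizationMonoid R]

theorem card_factors_mul {a b : R} (ha : a ≠ 0) (hb : b ≠ 0) :
    (factors (a * b)).card = (factors a).card + (factors b).card := by
  rw [Multiset.card_eq_card_of_rel (factors_mul ha hb), Multiset.card_add]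

theorem card_factors_pos {a : R} (ha : a ≠ 0) (hu : ¬ IsUnit a) : 0 < (factors a).card := by
  rw [Multiset.card_pos]
  intro h
  have := factors_prod ha
  rw [h, Multiset.prod_zero] at this
  exact hu (associated_one_iff_isUnit.mp this.symm)

theorem irreducible_of_card_factors_eq_one {a : R} (ha : a ≠ 0) (h : (factors a).card = 1) :
    Irreducible a := by
  obtain ⟨p, hp⟩ := Multiset.card_eq_one.mp h
  have h1 := factors_prod ha
  rw [hp, Multiset.prod_singleton] at h1
  exact h1.irreducible (irreducible_of_factor p (by rw [hp]; exact Multiset.mem_singleton_self p))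

/-- Each nonunit contributes at least one irreducible factor, and exactly one iff it is irreducible.
-/
theorem card_le_card_factors_prod [IsDomain R] {s : Multiset R} (hs0 : ∀ a ∈ s, a ≠ 0)
    (hsu : ∀ a ∈ s, ¬ IsUnit a) :
    s.card ≤ (factors s.prod).card ∧
      ((factors s.prod).card = s.card ↔ ∀ a ∈ s, Irreducible a) := by
  induction s using Multiset.induction_on with
  | empty => simp
  | cons a s ih =>
    have ih := ih (fun b hb => hs0 b (Multiset.mem_cons_of_mem hb))
      (fun b hb => hsu b (Multiset.mem_cons_of_mem hb))
    have ha0 := hs0 a (Multiset.mem_cons_self a s)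
    have hpos := card_factors_pos ha0 (hsu a (Multiset.mem_cons_self a s))
    have hprod : s.prod ≠ 0 :=
      Multiset.prod_ne_zero fun h => hs0 0 (Multiset.mem_cons_of_mem h) rfl
    rw [Multiset.prod_cons, card_factors_mul ha0 hprod, Multiset.card_cons, Multiset.forall_mem_cons,
      ← ih.2]
    refine ⟨by omega, fun h => ⟨irreducible_of_card_factors_eq_one ha0 (by omega), by omega⟩, ?_⟩
    rintro ⟨h1, h2⟩
    rw [card_factors_of_irreducible h1, h2, add_comm]

end FactorCount

/-! ### Linear forms over K and over L -/

section LinearForms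

/-- Up to scaling, a pair over `L` is defined over `K` or has transcendental ratio. -/
theorem exists_smul_or_transcendental {K L : Type*} [Field K] [IsAlgClosed K] [Field L]
    [Algebra K L] {p : L × L} (hp : p ≠ (0, 0)) :
    (∃ (a b : K) (γ : L), γ ≠ 0 ∧ (a, b) ≠ (0, 0) ∧ p = (γ * algebraMap K L a, γ * algebraMap K L b))
      ∨ (p.1 ≠ 0 ∧ Transcendental K (p.2 / p.1)) := by
  obtain ⟨α, β⟩ := p
  by_cases hα : α = 0
  · subst hα
    exact Or.inl ⟨0, 1, β, fun h => hp (by rw [h]), by simp, by simp⟩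
  · by_cases htr : Transcendental K (β / α)
    · exact Or.inr ⟨hα, htr⟩
    · left
      rw [Transcendental, not_not] at htr
      obtain ⟨c, hc⟩ := (IsAlgClosed.algebraMap_bijective_of_isIntegral (k := K)
        (K := integralClosure K L)).2 ⟨_, htr.isIntegral⟩
      have hc : algebraMap K L c = β / α := congrArg Subtype.val hc
      refine ⟨1, c, α, hα, by simp, ?_⟩
      rw [hc, mul_div_cancel₀ _ hα, map_one, mul_one]

theorem irreducible_linear_combination_iff {σ K L : Type*} [Field K] [Field L] [IsAlgClosed L]
    [Algebra K L] {p : L × L} (h1 : p.1 ≠ 0) (htr : Transcendental K (p.2 / p.1))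
    (φ ψ : MvPolynomial σ K) :
    Irreducible (C p.1 * map (algebraMap K L) φ + C p.2 * map (algebraMap K L) ψ) ↔
      Irreducible (map (algebraMap K (AlgebraicClosure (RatFunc K))) φ
        + C (algebraMap (RatFunc K) (AlgebraicClosure (RatFunc K)) RatFunc.X)
          * map (algebraMap K (AlgebraicClosure (RatFunc K))) ψ) := by
  rw [irreducible_pencil_iff htr]
  have hu : IsUnit (C p.1 : MvPolynomial σ L) := (isUnit_iff_ne_zero.mpr h1).map C
  have : C p.1 * map (algebraMap K L) φ + C p.2 * map (algebraMap K L) ψ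
      = C p.1 * (map (algebraMap K L) φ + C (p.2 / p.1) * map (algebraMap K L) ψ) := by
    rw [mul_add, ← mul_assoc, ← C_mul, mul_div_cancel₀ _ h1]
  rw [this, irreducible_isUnit_mul hu]

/-- Dividing a form by a linear form gives a form. -/
theorem isHomogeneous_of_linear_mul {L : Type*} [Field L] {l G H : MvPolynomial (Fin 2) L} {d : ℕ}
    (hl : l.IsHomogeneous 1) (hl0 : l ≠ 0) (hH : H.IsHomogeneous d) (hH0 : H ≠ 0) (h : H = l * G) :
    ∃ d', d = d' + 1 ∧ G.IsHomogeneous d' := by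
  have hG0 : G ≠ 0 := by rintro rfl; rw [mul_zero] at h; exact hH0 h
  have hcomp : ∀ i, homogeneousComponent (i + 1) (l * G) = l * homogeneousComponent i G := by
    intro i
    conv_lhs => rw [← sum_homogeneousComponent G, Finset.mul_sum, map_sum]
    have h1 : ∀ j, homogeneousComponent (i + 1) (l * homogeneousComponent j G)
        = if j = i then l * homogeneousComponent i G else 0 := by
      intro j
      rw [homogeneousComponent_of_mem ((mem_homogeneousSubmodule _ _).mpr
        (hl.mul (homogeneousComponent_isHomogeneous j G)))]
      by_cases hij : j = i
      · rw [if_pos hij, if_pos (by omega), hij]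
      · rw [if_neg hij, if_neg (by omega)]
    rw [Finset.sum_congr rfl fun j _ => h1 j, Finset.sum_ite_eq']
    split_ifs with hi
    · rfl
    · rw [homogeneousComponent_eq_zero i G (by simpa using hi), mul_zero]
  have hd : ∀ m, G.coeff m ≠ 0 → d = m.degree + 1 := by
    intro m hm
    by_contra hne
    have h1 := hcomp m.degree
    rw [← h, homogeneousComponent_of_mem ((mem_homogeneousSubmodule _ _).mpr hH),
      if_neg (Ne.symm hne)] at h1
    have h2 := (mul_eq_zero.mp h1.symm).resolve_left hl0
    have h3 := congrArg (coeff m) h2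
    rw [coeff_homogeneousComponent, if_pos rfl] at h3
    exact hm h3
  obtain ⟨m, hm⟩ := ne_zero_iff.mp hG0
  refine ⟨m.degree, hd m hm, ?_⟩
  have hG : homogeneousComponent m.degree G = G := by
    ext e
    rw [coeff_homogeneousComponent]
    split_ifs with he
    · rfl
    · by_contra hne
      have h1 := hd m hm
      have h2 := hd e (Ne.symm hne)
      omega
  rw [← hG]
  exact homogeneousComponent_isHomogeneous _ _

end LinearForms

/-! ### K-rational divisors of the linear family -/

section CoefficientFunctional

/-- Applying χ to coefficients commutes with multiplication by polynomials over K, so the quotient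
is carried along. -/
theorem dvd_of_map_dvd {σ K L : Type*} [Field K] [Field L] [Algebra K L] {p R : MvPolynomial σ K}
    {G : MvPolynomial σ L} (χ : L →ₗ[K] K) (h : map (algebraMap K L) p ∣ G)
    (hR : ∀ m, R.coeff m = χ (G.coeff m)) : p ∣ R := by
  classical
  obtain ⟨S, rfl⟩ := h
  refine ⟨∑ m ∈ S.support, monomial m (χ (S.coeff m)), ?_⟩
  have hcoeff : ∀ m, coeff m (∑ m ∈ S.support, monomial m (χ (S.coeff m))) = χ (S.coeff m) := by
    intro m
    rw [coeff_sum]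
    simp only [coeff_monomial]
    rw [Finset.sum_ite_eq' S.support m]
    split_ifs with hm
    · rfl
    · rw [notMem_support_iff.mp hm, map_zero]
  ext m
  rw [hR, coeff_mul, coeff_mul, map_sum]
  refine Finset.sum_congr rfl fun x _ => ?_
  rw [hcoeff, coeff_map, ← Algebra.smul_def, map_smul, smul_eq_mul]

/-- A polynomial over `K` that divides `P + λ₁ Q₁ + ⋯ + λ_ℓ Q_ℓ` divides `P` and all the `Qᵢ`. -/
theorem dvd_of_map_dvd_linearFamily {K : Type*} [Field K] {n ℓ : ℕ}
    {P : MvPolynomial (Fin n) K} {Q : Fin ℓ → MvPolynomial (Fin n) K} {p : MvPolynomial (Fin n) K}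
    (h : map (algebraMap K (ParamField K ℓ)) p ∣ linearFamily P Q) : p ∣ P ∧ ∀ i, p ∣ Q i := by
  classical
  let ι : MvPolynomial (Fin ℓ) K →ₗ[K] ParamField K ℓ :=
    (IsScalarTower.toAlgHom K (MvPolynomial (Fin ℓ) K) (ParamField K ℓ)).toLinearMap
  have hι : Function.Injective ι := by
    have : Function.Injective (algebraMap (MvPolynomial (Fin ℓ) K) (ParamField K ℓ)) := by
      rw [IsScalarTower.algebraMap_eq (MvPolynomial (Fin ℓ) K)
        (FractionRing (MvPolynomial (Fin ℓ) K)) (ParamField K ℓ)]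
      exact (algebraMap (FractionRing (MvPolynomial (Fin ℓ) K)) (ParamField K ℓ)).injective.comp
        (IsFractionRing.injective (MvPolynomial (Fin ℓ) K) (FractionRing (MvPolynomial (Fin ℓ) K)))
    exact this
  -- A K-linear retraction onto K[λ], followed by reading off the coefficient of 1 or of λᵢ,
  -- recovers P or Qᵢ from F.
  obtain ⟨π, hπ⟩ := ι.exists_leftInverse_of_injective (LinearMap.ker_eq_bot.mpr hι)
  have hcoeff : ∀ m, coeff m (linearFamily P Q)
      = ι (C (P.coeff m) + ∑ i, X i * C ((Q i).coeff m)) := by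
    intro m
    have h1 : ∀ c, ι (C c) = algebraMap K (ParamField K ℓ) c := fun c =>
      (IsScalarTower.toAlgHom K (MvPolynomial (Fin ℓ) K) (ParamField K ℓ)).commutes c
    have h2 : ∀ i, ι (X i) = param K i := fun i =>
      IsScalarTower.algebraMap_apply (MvPolynomial (Fin ℓ) K)
        (FractionRing (MvPolynomial (Fin ℓ) K)) (ParamField K ℓ) (X i)
    have h3 : ∀ a b, ι (a * b) = ι a * ι b := fun a b =>
      map_mul (IsScalarTower.toAlgHom K (MvPolynomial (Fin ℓ) K) (ParamField K ℓ)) a b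
    simp only [linearFamily, coeff_add, coeff_sum, coeff_C_mul, coeff_map, map_add, map_sum, h1,
      h2, h3]
  have hχ : ∀ (k : Fin ℓ →₀ ℕ) m, (lcoeff K k ∘ₗ π) (coeff m (linearFamily P Q))
      = coeff k (C (P.coeff m) + ∑ i, X i * C ((Q i).coeff m)) := by
    intro k m
    rw [hcoeff, LinearMap.comp_apply, ← LinearMap.comp_apply π, hπ]
    rfl
  refine ⟨dvd_of_map_dvd (lcoeff K 0 ∘ₗ π) h fun m => ?_, fun i =>
    dvd_of_map_dvd (lcoeff K (Finsupp.single i 1) ∘ₗ π) h fun m => ?_⟩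
  · rw [hχ]
    rw [coeff_add, coeff_sum, Finset.sum_eq_zero, coeff_zero_C, add_zero]
    intro i _
    rw [mul_comm, coeff_C_mul, coeff_zero_X, mul_zero]
  · rw [hχ, coeff_add, coeff_sum, coeff_C, if_neg (by simp [eq_comm]), zero_add,
      Finset.sum_eq_single i]
    · rw [mul_comm, coeff_C_mul, coeff_X, if_pos rfl, mul_one]
    · intro j _ hj
      rw [mul_comm, coeff_C_mul, coeff_X, if_neg, mul_zero]
      rw [Finsupp.single_left_inj one_ne_zero]
      exact hj
    · simp

end CoefficientFunctional

theorem totalDegree_map_le_totalDegree {σ R S : Type*} [CommRing R] [CommRing S] (f : R →+* S)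
    (p : MvPolynomial σ R) : (map f p).totalDegree ≤ p.totalDegree :=
  Finset.sup_mono (support_map_subset f p)

theorem algHom_aeval_pair {L A B : Type*} [CommRing L] [CommRing A] [CommRing B] [Algebra L A]
    [Algebra L B] (g : A →ₐ[L] B) (x : Fin 2 → A) (a b : B) (ha : g (x 0) = a) (hb : g (x 1) = b)
    (H : MvPolynomial (Fin 2) L) : g (aeval x H) = aeval ![a, b] H := by
  rw [comp_aeval_apply]
  congr 2
  ext i
  fin_cases i <;> simp [ha, hb]

/-! ### Decompositions: composedness, factor counts and descent -/

namespace HomogDecomp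

variable {K : Type*} [Field K] {L : Type*} [Field L] [Algebra K L] {n : ℕ}
  {F : MvPolynomial (Fin n) L}

/-- The polynomial `α φ + β ψ` over `L`, for a pair `p = (α, β)`. -/
def linComb (D : HomogDecomp K F) (p : L × L) : MvPolynomial (Fin n) L :=
  C p.1 * map (algebraMap K L) D.φ + C p.2 * map (algebraMap K L) D.ψ

theorem linComb_algebraMap (D : HomogDecomp K F) (a b : K) (γ : L) :
    D.linComb (γ * algebraMap K L a, γ * algebraMap K L b)
      = C γ * map (algebraMap K L) (C a * D.φ + C b * D.ψ) := by
  simp only [linComb, map_add, map_mul, map_C]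
  ring

theorem ne_zero (D : HomogDecomp K F) : F ≠ 0 := by
  rintro rfl
  simpa using D.totalDegree_lt

theorem H_ne_zero (D : HomogDecomp K F) : D.H ≠ 0 := by
  intro h
  apply D.ne_zero
  rw [D.eq_comp, h, map_zero]

theorem totalDegree_map_φ_lt (D : HomogDecomp K F) :
    (map (algebraMap K L) D.φ).totalDegree < F.totalDegree :=
  (totalDegree_map_le_totalDegree _ _).trans_lt ((le_max_left _ _).trans_lt D.totalDegree_lt)

theorem totalDegree_map_ψ_lt (D : HomogDecomp K F) :
    (map (algebraMap K L) D.ψ).totalDegree < F.totalDegree :=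
  (totalDegree_map_le_totalDegree _ _).trans_lt ((le_max_right _ _).trans_lt D.totalDegree_lt)

theorem zero_lt_max_totalDegree (D : HomogDecomp K F) :
    0 < max D.φ.totalDegree D.ψ.totalDegree := by
  by_contra! h
  have h1 : D.φ.totalDegree = 0 := by have := le_max_left D.φ.totalDegree D.ψ.totalDegree; omega
  have h2 : D.ψ.totalDegree = 0 := by have := le_max_right D.φ.totalDegree D.ψ.totalDegree; omega
  have h3 := D.totalDegree_lt
  have hF : F = C (aeval ![algebraMap K L (D.φ.coeff 0), algebraMap K L (D.ψ.coeff 0)] D.H) := by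
    refine D.eq_comp.trans (algHom_aeval_pair (Algebra.ofId L (MvPolynomial (Fin n) L)) _ _ _
      ?_ ?_ D.H).symm
    · conv_rhs => rw [totalDegree_eq_zero_iff_eq_C.mp h1, map_C]
      rfl
    · conv_rhs => rw [totalDegree_eq_zero_iff_eq_C.mp h2, map_C]
      rfl
  have h4 := congrArg MvPolynomial.totalDegree hF
  rw [totalDegree_C] at h4
  omega

/-- With r of degree at most 1, F could not have larger degree than S. -/
theorem isComposed_of_eq_aeval {S : MvPolynomial (Fin n) L} (hS : S.totalDegree < F.totalDegree)
    (r : Polynomial L) (h : F = Polynomial.aeval S r) : IsComposed F := by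
  refine ⟨r, S, ?_, h⟩
  by_contra! hlt
  obtain ⟨a, b, hab⟩ := Polynomial.exists_eq_X_add_C_of_natDegree_le_one (p := r) (by omega)
  have hle : F.totalDegree ≤ S.totalDegree := by
    rw [h, hab, map_add, map_mul, Polynomial.aeval_C, Polynomial.aeval_C, Polynomial.aeval_X,
      algebraMap_eq]
    refine (totalDegree_add _ _).trans (max_le ((totalDegree_mul _ _).trans ?_) ?_) <;> simp
  omega

/-- If some nontrivial combination of `φ` and `ψ` is constant, then `F` is composed. -/
theorem isComposed_of_linComb_eq_C (D : HomogDecomp K F) {p : L × L} (hp : p ≠ (0, 0)) {c : L}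
    (h : D.linComb p = C c) : IsComposed F := by
  obtain ⟨α, β⟩ := p
  have hexp : ∀ (S : MvPolynomial (Fin n) L) (r : Fin 2 → Polynomial L),
      Polynomial.aeval S (r 0) = map (algebraMap K L) D.φ →
      Polynomial.aeval S (r 1) = map (algebraMap K L) D.ψ →
      F = Polynomial.aeval S (aeval r D.H) := fun S r h0 h1 =>
    D.eq_comp.trans (algHom_aeval_pair (Polynomial.aeval S) r _ _ h0 h1 D.H).symm
  -- The constant combination expresses one of φ, ψ as a polynomial of degree at most 1 in the
  -- other, which then serves as S.
  by_cases hα : α = 0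
  · have hβ : β ≠ 0 := fun hβ => hp (by rw [hα, hβ])
    have h1 : C β * map (algebraMap K L) D.ψ = C c := by
      rw [← h, linComb, hα, C_0, zero_mul, zero_add]
    refine isComposed_of_eq_aeval D.totalDegree_map_φ_lt _
      (hexp _ ![Polynomial.X, Polynomial.C (c / β)] ?_ ?_)
    · simp
    · have hβ' : (C β : MvPolynomial (Fin n) L) ≠ 0 := by simpa using hβ
      apply mul_left_cancel₀ hβ'
      simp [h1, algebraMap_eq, ← C_mul, mul_div_cancel₀ _ hβ]
  · refine isComposed_of_eq_aeval D.totalDegree_map_ψ_lt _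
      (hexp _ ![Polynomial.C (c / α) - Polynomial.C (β / α) * Polynomial.X, Polynomial.X] ?_ ?_)
    · have hα' : (C α : MvPolynomial (Fin n) L) ≠ 0 := by simpa using hα
      apply mul_left_cancel₀ hα'
      simp only [Matrix.cons_val_zero, map_sub, map_mul, Polynomial.aeval_C,
        Polynomial.aeval_X, algebraMap_eq]
      rw [mul_sub, ← mul_assoc, ← C_mul, ← C_mul, mul_div_cancel₀ _ hα, mul_div_cancel₀ _ hα,
        ← h, linComb]
      ring
    · simp

theorem isReduced_of_not_isComposed (D : HomogDecomp K F) (hF : ¬ IsComposed F) :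
    D.IsReduced := by
  rintro ⟨a, b, hab, -, c, hc⟩
  refine hF (D.isComposed_of_linComb_eq_C (p := (1 * algebraMap K L a, 1 * algebraMap K L b))
    (c := algebraMap K L c) (by simpa using hab) ?_)
  rw [linComb_algebraMap, hc, C_1, one_mul, map_C]

theorem exists_eq_prod (D : HomogDecomp K F) [IsAlgClosed L] :
    ∃ (c : L) (s : Multiset (L × L)), c ≠ 0 ∧ s.card = D.degree ∧ (∀ p ∈ s, p ≠ (0, 0)) ∧
      D.H = C c * (s.map fun p => C p.1 * X 0 + C p.2 * X 1).prod ∧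
      F = C c * (s.map D.linComb).prod := by
  obtain ⟨c, s, hc, hcard, hs, hH⟩ := exists_eq_prod_linear_forms D.isHomogeneous D.H_ne_zero
  refine ⟨c, s, hc, hcard, hs, hH, ?_⟩
  conv_lhs => rw [D.eq_comp, hH]
  rw [map_mul, aeval_C, map_multiset_prod, Multiset.map_map, algebraMap_eq]
  congr 2
  refine Multiset.map_congr rfl fun p _ => ?_
  simp [linComb, algebraMap_eq]

/-- The number of irreducible factors of `F` bounds the degree of a decomposition all of whose
linear factors are nonconstant. -/
theorem degree_le_card_factors [IsAlgClosed L] (D : HomogDecomp K F) {c : L}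
    {s : Multiset (L × L)} (hc : c ≠ 0) (hcard : s.card = D.degree)
    (hF : F = C c * (s.map D.linComb).prod) (hu : ∀ p ∈ s, ¬ IsUnit (D.linComb p)) :
    D.degree ≤ (UniqueFactorizationMonoid.factors F).card ∧
      ((UniqueFactorizationMonoid.factors F).card = D.degree ↔
        ∀ p ∈ s, Irreducible (D.linComb p)) := by
  have hassoc : Associated (s.map D.linComb).prod F := by
    have hC : IsUnit (C c : MvPolynomial (Fin n) L) := (isUnit_iff_ne_zero.mpr hc).map C
    exact (associated_unit_mul_left _ _ hC).symm.trans (Associated.of_eq hF.symm)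
  have h0 : ∀ p ∈ s, D.linComb p ≠ 0 := by
    intro p hp h
    apply D.ne_zero
    refine hF.trans ?_
    rw [Multiset.prod_eq_zero (Multiset.mem_map.mpr ⟨p, hp, h⟩), mul_zero]
  have := card_le_card_factors_prod (s := s.map D.linComb)
    (Multiset.forall_mem_map_iff.mpr h0)
    (Multiset.forall_mem_map_iff.mpr hu)
  rw [← hassoc.card_factors_eq, ← hcard]
  simpa only [Multiset.card_map, Multiset.forall_mem_map_iff] using this

theorem linComb_dvd {c : L} {s : Multiset (L × L)} (D : HomogDecomp K F)
    (hF : F = C c * (s.map D.linComb).prod) {p : L × L} (hp : p ∈ s) : D.linComb p ∣ F :=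
  ((Multiset.dvd_prod (Multiset.mem_map_of_mem _ hp)).mul_left _).trans (dvd_of_eq hF.symm)

/-- A decomposition that is not maximal can be refined. -/
theorem exists_totalDegree_lt [IsAlgClosed K] (D : HomogDecomp K F) (hD : ¬ D.IsMaximal) :
    ∃ D' : HomogDecomp K F,
      max D'.φ.totalDegree D'.ψ.totalDegree < max D.φ.totalDegree D.ψ.totalDegree := by
  obtain ⟨φ', ψ', d, H₁, H₂, hrel, hlt, hH₁, hH₂, hφ, hψ⟩ :=
    exists_comp_of_not_irreducible D.isRelPrime D.zero_lt_max_totalDegree hD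
  refine ⟨⟨φ', ψ', hrel, hlt.trans D.totalDegree_lt,
    aeval ![map (algebraMap K L) H₁, map (algebraMap K L) H₂] D.H, d * D.degree, ?_, ?_⟩, hlt⟩
  · refine D.isHomogeneous.aeval _ fun i => ?_
    fin_cases i
    · exact hH₁.map _
    · exact hH₂.map _
  · have hmap : ∀ G : MvPolynomial (Fin 2) K,
        aeval ![map (algebraMap K L) φ', map (algebraMap K L) ψ'] (map (algebraMap K L) G)
          = map (algebraMap K L) (aeval ![φ', ψ'] G) := by
      intro G
      induction G using MvPolynomial.induction_on with
      | C a => simp [algebraMap_eq]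
      | add p q hp hq => simp only [map_add, hp, hq]
      | mul_X p i hp =>
        rw [map_mul, map_mul, map_mul, map_mul, hp]
        fin_cases i <;> simp
    refine D.eq_comp.trans (algHom_aeval_pair
      (aeval ![map (algebraMap K L) φ', map (algebraMap K L) ψ']) _ _ _ ?_ ?_ D.H).symm
    · exact (hmap H₁).trans (by rw [← hφ])
    · exact (hmap H₂).trans (by rw [← hψ])

theorem exists_isMaximal [IsAlgClosed K] (D : HomogDecomp K F) :
    ∃ D' : HomogDecomp K F, D'.IsMaximal := by
  induction h : max D.φ.totalDegree D.ψ.totalDegree using Nat.strong_induction_on generalizing D with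
  | _ m ih =>
    by_cases hD : D.IsMaximal
    · exact ⟨D, hD⟩
    · obtain ⟨D', hD'⟩ := D.exists_totalDegree_lt hD
      exact ih _ (h ▸ hD') D' rfl

/-- A decomposition that is not reduced can be shortened. -/
theorem exists_degree_lt (D : HomogDecomp K F) (hD : ¬ D.IsReduced) :
    ∃ D' : HomogDecomp K F, D'.φ = D.φ ∧ D'.ψ = D.ψ ∧ D'.degree < D.degree := by
  rw [IsReduced, not_not] at hD
  obtain ⟨a, b, hab, ⟨G, hG⟩, c, hc⟩ := hD
  have hl : (C (algebraMap K L a) * X 0 + C (algebraMap K L b) * X 1 :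
      MvPolynomial (Fin 2) L).IsHomogeneous 1 :=
    (isHomogeneous_C_mul_X _ _).add (isHomogeneous_C_mul_X _ _)
  have hl0 : (C (algebraMap K L a) * X 0 + C (algebraMap K L b) * X 1 :
      MvPolynomial (Fin 2) L) ≠ 0 := fun h => D.H_ne_zero (by rw [hG, h, zero_mul])
  obtain ⟨d, hd, hGd⟩ := isHomogeneous_of_linear_mul hl hl0 D.isHomogeneous D.H_ne_zero hG
  -- The linear factor is replaced by its constant value c; φ and ψ stay, so maximality is
  -- preserved.
  refine ⟨⟨D.φ, D.ψ, D.isRelPrime, D.totalDegree_lt, C (algebraMap K L c) * G, d,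
    by simpa using (isHomogeneous_C (Fin 2) (algebraMap K L c)).mul hGd, ?_⟩, rfl, rfl, ?_⟩
  · conv_lhs => rw [D.eq_comp, hG]
    rw [map_mul, map_mul]
    congr 1
    have := congrArg (map (algebraMap K L)) hc
    simpa [algebraMap_eq] using this
  · change d < D.degree
    omega

theorem exists_isReduced_isMaximal [IsAlgClosed K] (D : HomogDecomp K F) :
    ∃ D' : HomogDecomp K F, D'.IsReduced ∧ D'.IsMaximal := by
  obtain ⟨D, hD⟩ := D.exists_isMaximal
  induction h : D.degree using Nat.strong_induction_on generalizing D with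
  | _ m ih =>
    by_cases hr : D.IsReduced
    · exact ⟨D, hr, hD⟩
    · obtain ⟨D', hφ, hψ, hlt⟩ := D.exists_degree_lt hr
      refine ih _ (h ▸ hlt) D' ?_ rfl
      rw [IsMaximal, hφ, hψ]
      exact hD

end HomogDecomp

/-! ### The main theorem -/

theorem corollary2p6 {K : Type*} [Field K] [IsAlgClosed K] (n ℓ : ℕ) (hn : 2 ≤ n) (hℓ : 1 ≤ ℓ)
    (P : MvPolynomial (Fin n) K) (Q : Fin ℓ → MvPolynomial (Fin n) K)
    (hP : P ≠ 0) (hQ : ∀ i, Q i ≠ 0)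
    (hPQ : ∀ i, ¬ Associated P (Q i))
    (hQQ : ∀ i j, i ≠ j → ¬ Associated (Q i) (Q j))
    (hdeg : 0 < P.totalDegree ∨ ∃ i, 0 < (Q i).totalDegree)
    (hprime : ∀ A : MvPolynomial (Fin n) K, A ∣ P → (∀ i, A ∣ Q i) → IsUnit A) :
    ∃ δ : ℕ,
      (Nonempty (HomogDecomp K (linearFamily P Q)) →
        ∃ D : HomogDecomp K (linearFamily P Q), D.IsReduced ∧ D.IsMaximal) ∧
      (∀ D : HomogDecomp K (linearFamily P Q), D.IsReduced → D.IsMaximal → D.degree = δ) ∧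
      (¬ IsComposed (linearFamily P Q) →
        ∀ D : HomogDecomp K (linearFamily P Q),
          D.degree ≤ δ ∧ (D.degree = δ ↔ D.IsMaximal)) := by
  -- a linear factor of `F` over `K` is constant, since `K`-rational divisors divide `P` and the `Qᵢ`
  have hconst : ∀ (D : HomogDecomp K (linearFamily P Q)) (a b : K) (γ : ParamField K ℓ), γ ≠ 0 →
      D.linComb (γ * algebraMap K (ParamField K ℓ) a, γ * algebraMap K (ParamField K ℓ) b)
        ∣ linearFamily P Q → ∃ c, C a * D.φ + C b * D.ψ = C c := by
    intro D a b γ hγ h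
    rw [D.linComb_algebraMap] at h
    obtain ⟨h1, h2⟩ := dvd_of_map_dvd_linearFamily (dvd_of_mul_left_dvd h)
    obtain ⟨c, -, hc⟩ := isUnit_iff_eq_C_of_isReduced.mp (hprime _ h1 h2)
    exact ⟨c, hc⟩
  have hmax : ∀ D : HomogDecomp K (linearFamily P Q), D.IsReduced → D.IsMaximal →
      D.degree = (UniqueFactorizationMonoid.factors (linearFamily P Q)).card := by
    intro D hred hmax
    obtain ⟨c, s, hc, hcard, hs, hH, hF⟩ := D.exists_eq_prod
    have hirr : ∀ p ∈ s, Irreducible (D.linComb p) := by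
      intro p hp
      rcases exists_smul_or_transcendental (K := K) (hs p hp) with
        ⟨a, b, γ, hγ, hab, rfl⟩ | ⟨h1, htr⟩
      · refine (hred ⟨a, b, hab, ?_, hconst D a b γ hγ (D.linComb_dvd hF hp)⟩).elim
        rw [hH]
        refine Dvd.dvd.mul_left (dvd_trans ⟨C γ, ?_⟩ (Multiset.dvd_prod (Multiset.mem_map_of_mem _ hp))) _
        simp only [C_mul]
        ring
      · exact (irreducible_linear_combination_iff h1 htr D.φ D.ψ).mpr hmax
    exact ((D.degree_le_card_factors hc hcard hF fun p hp => (hirr p hp).not_isUnit).2.mpr hirr).symm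
  -- δ is the number of irreducible factors of F over L, counted with multiplicity.
  refine ⟨(UniqueFactorizationMonoid.factors (linearFamily P Q)).card, fun ⟨D⟩ =>
    D.exists_isReduced_isMaximal, hmax, fun hcomp D => ?_⟩
  obtain ⟨c, s, hc, hcard, hs, -, hF⟩ := D.exists_eq_prod
  have hu : ∀ p ∈ s, ¬ IsUnit (D.linComb p) := by
    intro p hp h
    obtain ⟨e, -, he⟩ := isUnit_iff_eq_C_of_isReduced.mp h
    exact hcomp (D.isComposed_of_linComb_eq_C (hs p hp) he)
  have hdegree := D.degree_le_card_factors hc hcard hF hu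
  refine ⟨hdegree.1, fun h => ?_, hmax D (D.isReduced_of_not_isComposed hcomp)⟩
  -- A single linear factor is enough to test maximality; one exists because F is not constant.
  have hpos : 0 < s.card := by
    rw [Multiset.card_pos]
    rintro rfl
    have h1 := D.totalDegree_lt
    have h2 := congrArg MvPolynomial.totalDegree hF
    rw [Multiset.map_zero, Multiset.prod_zero, mul_one, totalDegree_C] at h2
    omega
  obtain ⟨p, hp⟩ := Multiset.card_pos_iff_exists_mem.mp hpos
  rcases exists_smul_or_transcendental (K := K) (hs p hp) with
    ⟨a, b, γ, hγ, hab, rfl⟩ | ⟨h1, htr⟩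
  -- A factor proportional to a K-rational one would be constant and make F composed, so the chosen
  -- factor has transcendental ratio.
  · obtain ⟨e, he⟩ := hconst D a b γ hγ (D.linComb_dvd hF hp)
    refine (hcomp (D.isComposed_of_linComb_eq_C (hs _ hp) (c := γ * algebraMap K _ e) ?_)).elim
    rw [D.linComb_algebraMap, he, map_C, C_mul]
  · exact (irreducible_linear_combination_iff h1 htr D.φ D.ψ).mp (hdegree.2.mp h.symm p hp)

end
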